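/- For $n\geqslant1$ let $a_n$ be the number of permutations of $\{1,\ldots,n\}$ that avoid both patterns $1243$ and $2314$, i.e. that have no subsequence of four terms in the same relative order as $1243$ or as $2314$, and let $F(z)=\sum_{n\geqslant1}a_nz^n$ be the generating function of this class. Then: 1. $F$ is algebraic (over $\mathbb{Q}(z)$) and satisfies, as a formal power series, the cubic equation $$(z-3z^2+2z^3)-(1-5z+8z^2-5z^3)F(z)+(2z-5z^2+4z^3)F(z)^2+z^3F(z)^3=0.$$ 2. The growth rate $\gamma=\lim_{n\to\infty}a_n^{1/n}$ of the class exists and is equal to the greatest real root of the quintic polynomial $2-41z+101z^2-97z^3+36z^4-4z^5$; approximately, $\gamma\approx5.1955$ (that is, $|\gamma-5.1955|<5\cdot10^{-5}$). -/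

import Mathlib

/-- The pattern `τ` is contained in `σ`: some subsequence of `σ` (at the positions
`e 0 < e 1 < ...`) is order isomorphic to `τ`. -/
def PermContains {n k : ℕ} (σ : Equiv.Perm (Fin n)) (τ : Equiv.Perm (Fin k)) : Prop :=
  ∃ e : Fin k ↪o Fin n, ∀ i j : Fin k, σ (e i) < σ (e j) ↔ τ i < τ j

/-- `permAv B n` is the set of permutations of length `n` that contain no element of `B`.
Permutations are arrangements of `1, ..., n` for a positive `n`, so there are none of length 0. -/
def permAv (B : Set (Σ k : ℕ, Equiv.Perm (Fin k))) (n : ℕ) : Set (Equiv.Perm (Fin n)) :=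
  {σ | 0 < n ∧ ∀ τ ∈ B, ¬ PermContains σ τ.2}

/-- The ordinary generating function of a family of permutations, given length by length. -/
noncomputable def permGenFun (C : ∀ n : ℕ, Set (Equiv.Perm (Fin n))) : PowerSeries ℚ :=
  PowerSeries.mk fun n => (Nat.card (C n) : ℚ)

/-- The growth rate `lim |C_n|^(1/n)` of a family of permutations exists and equals `γ`. -/
def HasGrowthRate (C : ∀ n : ℕ, Set (Equiv.Perm (Fin n))) (γ : ℝ) : Prop :=
  Filter.Tendsto (fun n : ℕ => (Nat.card (C n) : ℝ) ^ (1 / (n : ℝ))) Filter.atTop (nhds γ)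

/-- The permutation with one-line notation 1243 (values and positions counted from 0). -/
def perm1243 : Equiv.Perm (Fin 4) :=
  ⟨![0, 1, 3, 2], ![0, 1, 3, 2], by decide, by decide⟩

/-- The permutation with one-line notation 2314 (values and positions counted from 0). -/
def perm2314 : Equiv.Perm (Fin 4) :=
  ⟨![1, 2, 0, 3], ![2, 0, 1, 3], by decide, by decide⟩

/-- The class of permutations avoiding 1243 and 2314. -/
def classE : ∀ n : ℕ, Set (Equiv.Perm (Fin n)) :=
  permAv {⟨4, perm1243⟩, ⟨4, perm2314⟩}

/-! Permutations of the class are generated by inserting a new maximum. It can only play the 4 of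
either pattern, so legality depends only on the insertion site (`wordAvoids_insertMax`). Let `r` be
the length of the initial decreasing run; sites `0, ..., r` are always active. The later active
sites are `h` high ones (before them, every letter outside the run exceeds the first letter) and `l`
low ones. The label `(r, h, l)` determines the labels of all children: site 0 gives `(r+1, 0, h+l)`,
a site `0 < p < r` gives `(p, 1, 0)`, site `r` gives `(r, h+1, 0)`, a high site gives `(r, 1, 0)`
and a low site gives `(r, 0, 1)`.

Each of these is linear in `h` and `l`, so the rule acts on statistics `α(r) + h β(r) + l γ(r)`
(`sum_siteWeight_insertMax`). Iterating this transposed operator on the constant 1 and evaluating at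
the permutation 1 gives the counting sequence (`card_classE_succ`). The generating functions of the
iterates are geometric in `r`, with ratio a power series `L` fixed by a kernel equation
(`labelWeight_eq_coeff`). Hence `F = zL(1+F)`, and with `w = zL = F/(1+F)` the kernel equation
`(1-2z)(1-z-w)(w-z-w²) = z²(1-z)w` becomes the cubic (`classSeries_cubic`).

For the growth rate no singularity analysis is used. At `x = 1/γ` the kernel cubic has a double root
`w₀` (`exists_double_root`), hence the positive system has a nonnegative real solution there, which
bounds all partial sums of `F` (`partialEval_le_of_system`). Since `1 + F = 1/(1-zL)`, its
coefficients are supermultiplicative and the limit of the roots exists and is at most `γ`. Were it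
smaller, `F` would converge at some point beyond `x` and give a nonnegative solution there, which
the sign of the factored cubic forbids (`no_solution_of_gt`). -/

/-- The word obtained from the first `n` letters of `w` by inserting the letter `n` at site `p`. -/
def insertMax (w : ℕ → ℕ) (n p : ℕ) : ℕ → ℕ :=
  fun m => if m < p then w m else if m = p then n else w (m - 1)

/-- The prefix of length `p` of `w` is decreasing. -/
def DecPrefix (w : ℕ → ℕ) (p : ℕ) : Prop :=
  ∀ i j, i < j → j < p → w j < w i

/-- The first `n` letters of `w` avoid 1243 and 2314. -/
def WordAvoids (w : ℕ → ℕ) (n : ℕ) : Prop :=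
  ∀ i j k l, i < j → j < k → k < l → l < n →
    ¬(w i < w j ∧ w j < w l ∧ w l < w k) ∧ ¬(w k < w i ∧ w i < w j ∧ w j < w l)

/-- Inserting a new maximum at site `p` creates neither 1243 nor 2314. -/
def ActiveSite (w : ℕ → ℕ) (n p : ℕ) : Prop :=
  (∀ i j k, i < j → j < p → p ≤ k → k < n → ¬(w i < w j ∧ w j < w k)) ∧
    ∀ i j k, i < j → j < k → k < p → ¬(w k < w i ∧ w i < w j)

/-- The first `n` letters of `w` are distinct and less than `n`. -/
def IsPermWord (w : ℕ → ℕ) (n : ℕ) : Prop :=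
  (∀ i < n, w i < n) ∧ ∀ i < n, ∀ j < n, w i = w j → i = j

/-- An active site whose prefix is not decreasing. -/
def AscSite (w : ℕ → ℕ) (n p : ℕ) : Prop :=
  p ≤ n ∧ ¬DecPrefix w p ∧ ActiveSite w n p

/-- Every letter before `p` lies in the initial decreasing run or is at least the first letter. -/
def AboveFirst (w : ℕ → ℕ) (p : ℕ) : Prop :=
  ∀ m < p, w m < w 0 → DecPrefix w (m + 1)

/-! ### Active sites under insertion of a new maximum -/

section insertMax

variable {w : ℕ → ℕ} {n p q : ℕ}

theorem insertMax_of_lt {m : ℕ} (h : m < p) : insertMax w n p m = w m := by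
  simp [insertMax, h]

theorem insertMax_self : insertMax w n p p = n := by
  simp [insertMax]

theorem insertMax_succ {m : ℕ} (h : p ≤ m) : insertMax w n p (m + 1) = w m := by
  have h1 : ¬ m + 1 < p := by omega
  have h2 : m + 1 ≠ p := by omega
  simp [insertMax, h1, h2]

theorem DecPrefix.mono (h : DecPrefix w p) (hq : q ≤ p) : DecPrefix w q :=
  fun i j hij hj => h i j hij (by omega)

theorem DecPrefix.activeSite (h : DecPrefix w p) : ActiveSite w n p :=
  ⟨fun i j k hij hj _ _ => by have := h i j hij hj; omega,
    fun i j k hij hjk hk => by have := h i j hij (by omega); omega⟩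

theorem not_decPrefix_iff (hw : IsPermWord w n) (hp : p ≤ n) :
    ¬DecPrefix w p ↔ ∃ i j, i < j ∧ j < p ∧ w i < w j := by
  constructor
  · intro h
    by_contra! hc
    refine h fun i j hij hj => lt_of_le_of_ne (hc i j hij hj) fun he => ?_
    have := hw.2 j (by omega) i (by omega) he
    omega
  · rintro ⟨i, j, hij, hj, hlt⟩ h
    have := h i j hij hj
    omega

theorem decPrefix_insertMax_of_le (hq : q ≤ p) :
    DecPrefix (insertMax w n p) q ↔ DecPrefix w q := by
  refine forall₄_congr fun i j hij hj => ?_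
  rw [insertMax_of_lt (by omega), insertMax_of_lt (by omega)]

/-- The new maximum must be the 4 of any occurrence it takes part in: third in 1243, last in 2314.
The two clauses of `ActiveSite` are what remains of the patterns. -/
theorem wordAvoids_insertMax (hw : IsPermWord w n) (hp : p ≤ n) :
    WordAvoids (insertMax w n p) (n + 1) ↔ WordAvoids w n ∧ ActiveSite w n p := by
  have hlt := hw.1
  constructor
  · intro h
    refine ⟨fun i j k l hij hjk hkl hl => ?_, fun i j k hij hj hk hkn => ?_,
      fun i j k hij hjk hk => ?_⟩
    -- Positions of `w` are reindexed so as to skip the inserted letter.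
    · have := h (if i < p then i else i + 1) (if j < p then j else j + 1)
        (if k < p then k else k + 1) (if l < p then l else l + 1)
        (by split_ifs <;> omega) (by split_ifs <;> omega) (by split_ifs <;> omega)
        (by split_ifs <;> omega)
      have key : ∀ m, insertMax w n p (if m < p then m else m + 1) = w m := by
        intro m
        split_ifs with hm
        · exact insertMax_of_lt hm
        · exact insertMax_succ (by omega)
      simpa only [key] using this
    · have := (h i j p (k + 1) hij hj (by omega) (by omega)).1
      rw [insertMax_of_lt (by omega), insertMax_of_lt hj, insertMax_self,
        insertMax_succ hk] at this
      exact fun hc => this ⟨hc.1, hc.2, hlt k hkn⟩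
    · have := (h i j k p hij hjk hk (by omega)).2
      rw [insertMax_of_lt (show i < p by omega), insertMax_of_lt (show j < p by omega),
        insertMax_of_lt hk, insertMax_self] at this
      exact fun hc => this ⟨hc.1, hc.2, hlt j (by omega)⟩
  · rintro ⟨h, h1, h2⟩ i j k l hij hjk hkl hl
    have key : ∀ m, m < n + 1 → (m < p ∧ insertMax w n p m = w m ∧ w m < n) ∨
        (m = p ∧ insertMax w n p m = n) ∨
        (p < m ∧ insertMax w n p m = w (m - 1) ∧ w (m - 1) < n) := by
      intro m hm
      rcases lt_trichotomy m p with hc | hc | hc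
      · exact Or.inl ⟨hc, insertMax_of_lt hc, hlt m (by omega)⟩
      · exact Or.inr (Or.inl ⟨hc, hc ▸ insertMax_self⟩)
      · obtain ⟨m, rfl⟩ := Nat.exists_eq_succ_of_ne_zero (show m ≠ 0 by omega)
        exact Or.inr (Or.inr ⟨hc, insertMax_succ (by omega), hlt m (by omega)⟩)
    have ki := key i (by omega)
    have kj := key j (by omega)
    have kk := key k (by omega)
    have kl := key l (by omega)
    have o : ∀ m, m < n + 1 → m ≠ p → ∃ m', m' < n ∧ insertMax w n p m = w m' ∧
        m' = (if m < p then m else m - 1) := by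
      intro m hm hne
      rcases key m hm with hc | hc | hc
      · exact ⟨m, by omega, hc.2.1, by simp [hc.1]⟩
      · exact absurd hc.1 hne
      · exact ⟨m - 1, by omega, hc.2.1, by rw [if_neg (by omega)]⟩
    -- The maximum cannot be the first or second letter of an occurrence, because a larger letter
    -- follows in both patterns.
    by_cases hi : i = p
    · constructor <;> omega
    by_cases hj : j = p
    · constructor <;> omega
    obtain ⟨i', hi', ei, di⟩ := o i (by omega) hi
    obtain ⟨j', hj', ej, dj⟩ := o j (by omega) hj
    by_cases hk : k = p
    · obtain ⟨l', hl', el, dl⟩ := o l (by omega) (by omega)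
      have := h1 i' j' l' (by split_ifs at * <;> omega) (by split_ifs at * <;> omega)
        (by split_ifs at * <;> omega) hl'
      constructor <;> omega
    obtain ⟨k', hk', ek, dk⟩ := o k (by omega) hk
    by_cases hl0 : l = p
    · have := h2 i' j' k' (by split_ifs at * <;> omega) (by split_ifs at * <;> omega)
        (by split_ifs at * <;> omega)
      constructor <;> omega
    obtain ⟨l', hl', el, dl⟩ := o l (by omega) hl0
    have := h i' j' k' l' (by split_ifs at * <;> omega) (by split_ifs at * <;> omega)
        (by split_ifs at * <;> omega) hl'
    rw [ei, ej, ek, el]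
    exact this

theorem decPrefix_insertMax_zero (hw : IsPermWord w n) (hq : q ≤ n) :
    DecPrefix (insertMax w n 0) (q + 1) ↔ DecPrefix w q := by
  constructor
  · intro h i j hij hj
    have := h (i + 1) (j + 1) (by omega) (by omega)
    rwa [insertMax_succ (by omega), insertMax_succ (by omega)] at this
  · intro h i j hij hj
    obtain ⟨j, rfl⟩ := Nat.exists_eq_succ_of_ne_zero (show j ≠ 0 by omega)
    rw [Nat.succ_eq_add_one, insertMax_succ (by omega)]
    rcases i with _ | i
    · rw [insertMax_self]
      exact hw.1 j (by omega)
    · rw [insertMax_succ (by omega)]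
      exact h i j (by omega) (by omega)

theorem not_decPrefix_insertMax (hw : IsPermWord w n) (hp0 : 0 < p) (hp : p ≤ n) (hq : p ≤ q) :
    ¬DecPrefix (insertMax w n p) (q + 1) := by
  intro h
  have := h 0 p hp0 (by omega)
  rw [insertMax_of_lt hp0, insertMax_self] at this
  have := hw.1 0 (by omega)
  omega

/-- To the right of the inserted maximum, the only new obstruction is a 231 whose 3 is that maximum:
a letter before `p` with a smaller letter between `p` and the site. -/
theorem activeSite_insertMax (hw : IsPermWord w n) (hq : p ≤ q) (hqn : q ≤ n) :
    ActiveSite (insertMax w n p) (n + 1) (q + 1) ↔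
      ActiveSite w n q ∧ ∀ i k, i < p → p ≤ k → k < q → w i < w k := by
  have hlt := hw.1
  constructor
  · rintro ⟨h1, h2⟩
    have key : ∀ m, insertMax w n p (if m < p then m else m + 1) = w m := by
      intro m
      split_ifs with hm
      · exact insertMax_of_lt hm
      · exact insertMax_succ (by omega)
    refine ⟨⟨fun i j k hij hj hk hkn => ?_, fun i j k hij hjk hk => ?_⟩,
      fun i k hi hk hkq => ?_⟩
    · have := h1 (if i < p then i else i + 1) (if j < p then j else j + 1)
        (if k < p then k else k + 1) (by split_ifs <;> omega) (by split_ifs <;> omega)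
        (by split_ifs <;> omega) (by split_ifs <;> omega)
      simpa only [key] using this
    · have := h2 (if i < p then i else i + 1) (if j < p then j else j + 1)
        (if k < p then k else k + 1) (by split_ifs <;> omega) (by split_ifs <;> omega)
        (by split_ifs <;> omega)
      simpa only [key] using this
    · have := h2 i p (k + 1) hi (by omega) (by omega)
      rw [insertMax_of_lt hi, insertMax_self, insertMax_succ hk] at this
      have hne : w i ≠ w k := fun he => by
        have := hw.2 i (by omega) k (by omega) he
        omega
      have := hlt i (by omega)
      omega
  · rintro ⟨⟨h1, h2⟩, h3⟩
    have o : ∀ m, m < n + 1 → (m = p ∧ insertMax w n p m = n) ∨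
        ∃ m', m' < n ∧ insertMax w n p m = w m' ∧ w m' < n ∧
          (m < p ∧ m' = m ∨ p < m ∧ m = m' + 1) := by
      intro m hm
      rcases lt_trichotomy m p with hc | hc | hc
      · exact Or.inr ⟨m, by omega, insertMax_of_lt hc, hlt m (by omega), by omega⟩
      · exact Or.inl ⟨hc, hc ▸ insertMax_self⟩
      · obtain ⟨m, rfl⟩ := Nat.exists_eq_succ_of_ne_zero (show m ≠ 0 by omega)
        exact Or.inr ⟨m, by omega, insertMax_succ (by omega), hlt m (by omega), by omega⟩
    constructor
    · intro i j k hij hj hk hkn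
      rcases o i (by omega) with ⟨hi, ei⟩ | ⟨i', hi', ei, li, di⟩
      · rcases o j (by omega) with ⟨hj, ej⟩ | ⟨j', hj', ej, lj, dj⟩ <;> omega
      rcases o k (by omega) with ⟨hk, ek⟩ | ⟨k', hk', ek, lk, dk⟩
      · omega
      rcases o j (by omega) with ⟨hj, ej⟩ | ⟨j', hj', ej, lj, dj⟩
      · omega
      have := h1 i' j' k' (by omega) (by omega) (by omega) hk'
      omega
    · intro i j k hij hjk hk
      rcases o i (by omega) with ⟨hi, ei⟩ | ⟨i', hi', ei, li, di⟩
      · rcases o j (by omega) with ⟨hj, ej⟩ | ⟨j', hj', ej, lj, dj⟩ <;> omega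
      rcases o k (by omega) with ⟨hk, ek⟩ | ⟨k', hk', ek, lk, dk⟩
      · omega
      rcases o j (by omega) with ⟨hj, ej⟩ | ⟨j', hj', ej, lj, dj⟩
      · have := h3 i' k' (by omega) (by omega) (by omega)
        omega
      have := h2 i' j' k' (by omega) (by omega) (by omega)
      omega

/-- An ascent before a site at or left of the new maximum would, with that maximum to its right, be
the 12 and 3 of a 1243 whose 4 goes into the site. -/
theorem AscSite.lt_of_insertMax (hw : IsPermWord w n) (hp : p ≤ n)
    (h : AscSite (insertMax w n p) (n + 1) q) : p < q := by
  obtain ⟨hq, hd, ha⟩ := h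
  by_contra! hc
  rw [decPrefix_insertMax_of_le hc, not_decPrefix_iff hw (by omega)] at hd
  obtain ⟨i, j, hij, hj, hlt⟩ := hd
  refine ha.1 i j p hij hj hc (by omega) ?_
  rw [insertMax_of_lt (by omega), insertMax_of_lt (by omega), insertMax_self]
  exact ⟨hlt, hw.1 j (by omega)⟩

theorem ascSite_insertMax_zero (hw : IsPermWord w n) :
    AscSite (insertMax w n 0) (n + 1) q ↔ ∃ q', q = q' + 1 ∧ AscSite w n q' := by
  constructor
  · intro h
    have hpos := AscSite.lt_of_insertMax hw (Nat.zero_le n) h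
    obtain ⟨q, rfl⟩ := Nat.exists_eq_succ_of_ne_zero hpos.ne'
    obtain ⟨hq, hd, ha⟩ := h
    rw [Nat.succ_eq_add_one] at *
    rw [decPrefix_insertMax_zero hw (by omega)] at hd
    rw [activeSite_insertMax hw (by omega) (by omega)] at ha
    exact ⟨q, rfl, by omega, hd, ha.1⟩
  · rintro ⟨q, rfl, hq, hd, ha⟩
    refine ⟨by omega, ?_, ?_⟩
    · rwa [decPrefix_insertMax_zero hw (by omega)]
    · rw [activeSite_insertMax hw (by omega) (by omega)]
      exact ⟨ha, fun i k hi => by omega⟩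

/-- Once the first letter is the maximum, all other letters lie below it, so a high site would have
a decreasing prefix. -/
theorem not_aboveFirst_insertMax_zero (hw : IsPermWord w n)
    (h : AscSite (insertMax w n 0) (n + 1) q) : ¬AboveFirst (insertMax w n 0) q := by
  intro hab
  have hpos := AscSite.lt_of_insertMax hw (Nat.zero_le n) h
  obtain ⟨q, rfl⟩ := Nat.exists_eq_succ_of_ne_zero hpos.ne'
  obtain ⟨hq, hd, ha⟩ := h
  rw [Nat.succ_eq_add_one] at *
  refine hd ?_
  rcases q with _ | q
  · exact fun i j hij hj => by omega
  · refine hab (q + 1) (by omega) ?_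
    rw [insertMax_self, insertMax_succ (by omega)]
    exact hw.1 q (by omega)

theorem ascSite_insertMax_of_pos (hw : IsPermWord w n) (hp0 : 0 < p) (hp : p ≤ n) :
    AscSite (insertMax w n p) (n + 1) q ↔ ∃ q', q = q' + 1 ∧ p ≤ q' ∧ q' ≤ n ∧
      ActiveSite w n q' ∧ ∀ i k, i < p → p ≤ k → k < q' → w i < w k := by
  constructor
  · intro h
    have hpos := AscSite.lt_of_insertMax hw hp h
    obtain ⟨q, rfl⟩ := Nat.exists_eq_succ_of_ne_zero (show q ≠ 0 by omega)
    obtain ⟨hq, hd, ha⟩ := h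
    rw [Nat.succ_eq_add_one] at *
    rw [activeSite_insertMax hw (by omega) (by omega)] at ha
    exact ⟨q, rfl, by omega, by omega, ha⟩
  · rintro ⟨q, rfl, hpq, hq, ha⟩
    exact ⟨by omega, not_decPrefix_insertMax hw hp0 hp hpq,
      (activeSite_insertMax hw hpq hq).2 ha⟩

theorem aboveFirst_insertMax (hw : IsPermWord w n) (hp0 : 0 < p) (hp : p ≤ n) (hpq : p ≤ q)
    (hab : ∀ k, p ≤ k → k < q → w 0 < w k) :
    AboveFirst (insertMax w n p) (q + 1) ↔ AboveFirst w p := by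
  have h0 : insertMax w n p 0 = w 0 := insertMax_of_lt hp0
  constructor
  · intro h m hm hlt
    have := h m (by omega)
    rw [h0, insertMax_of_lt hm, decPrefix_insertMax_of_le (by omega)] at this
    exact this hlt
  · intro h m hm hlt
    rw [h0] at hlt
    rcases lt_trichotomy m p with hc | rfl | hc
    · rw [insertMax_of_lt hc] at hlt
      rw [decPrefix_insertMax_of_le (by omega)]
      exact h m hc hlt
    · rw [insertMax_self] at hlt
      have := hw.1 0 (by omega)
      omega
    · obtain ⟨m, rfl⟩ := Nat.exists_eq_succ_of_ne_zero (show m ≠ 0 by omega)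
      rw [Nat.succ_eq_add_one, insertMax_succ (by omega)] at hlt
      have := hab m (by omega) (by omega)
      omega

theorem DecPrefix.aboveFirst (h : DecPrefix w p) : AboveFirst w p :=
  fun _ hm _ => h.mono hm

/-- If a site further right survived, the letter following the insertion would exceed the ascent
before `p`, and `p` itself would have been inactive because of 1243. -/
theorem ascSite_insertMax_of_ascSite (hw : IsPermWord w n) (h : AscSite w n p) :
    AscSite (insertMax w n p) (n + 1) q ↔ q = p + 1 := by
  obtain ⟨hp, hd, ha⟩ := h
  rw [not_decPrefix_iff hw hp] at hd
  obtain ⟨i, j, hij, hj, hlt⟩ := hd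
  rw [ascSite_insertMax_of_pos hw (by omega) hp]
  constructor
  · rintro ⟨q, rfl, hpq, hq, hact, hab⟩
    by_contra hne
    have := hab j p hj le_rfl (by omega)
    exact ha.1 i j p hij hj le_rfl (by omega) ⟨hlt, this⟩
  · rintro rfl
    exact ⟨p, rfl, le_rfl, hp, ha, fun i k _ h1 h2 => by omega⟩

/-- The first letter is the largest of a decreasing prefix, so the survival condition of
`activeSite_insertMax` only compares with `w 0`. A survivor other than `p + 1` needs `w p` above `w
0`, which forces the run to end exactly at `p`. -/
theorem ascSite_insertMax_of_decPrefix (hw : IsPermWord w n) (hp0 : 0 < p) (hp : p ≤ n)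
    (hd : DecPrefix w p) :
    AscSite (insertMax w n p) (n + 1) q ↔ q = p + 1 ∨
      ∃ q', q = q' + 1 ∧ ¬DecPrefix w (p + 1) ∧ AscSite w n q' ∧ AboveFirst w q' := by
  rw [ascSite_insertMax_of_pos hw hp0 hp]
  constructor
  · rintro ⟨q, rfl, hpq, hq, hact, hab⟩
    rcases hpq.eq_or_lt with rfl | hpq
    · exact Or.inl rfl
    · have hd' : ¬DecPrefix w (p + 1) := fun h => by
        have h1 := h 0 p hp0 (by omega)
        have h2 := hab 0 p hp0 le_rfl hpq
        omega
      refine Or.inr ⟨q, rfl, hd', ⟨hq, fun h => hd' (h.mono hpq), hact⟩, fun m hm hlt => ?_⟩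
      by_cases hmp : m < p
      · exact hd.mono hmp
      · have := hab 0 m hp0 (by omega) hm
        omega
  · rintro (rfl | ⟨q, rfl, hd', ⟨hq, hdq, hact⟩, hab⟩)
    · exact ⟨p, rfl, le_rfl, hp, hd.activeSite, fun i k _ h1 h2 => by omega⟩
    · have hpq : p < q := by
        by_contra! hc
        exact hdq (hd.mono hc)
      refine ⟨q, rfl, hpq.le, hq, hact, fun i k hi hpk hkq => ?_⟩
      have h0 : w 0 < w k := by
        by_contra! hc
        rcases hc.lt_or_eq with hc | hc
        · exact hd' ((hab k hkq hc).mono (by omega))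
        · have := hw.2 k (by omega) 0 (by omega) hc
          omega
      rcases Nat.eq_zero_or_pos i with rfl | hi0
      · exact h0
      · exact (hd 0 i hi0 hi).trans h0

end insertMax

/-! ### The succession rule on labels -/

section SiteCounts

open Classical in
/-- The length of the initial decreasing run among the first `n` letters of `w`. -/
noncomputable def decRun (w : ℕ → ℕ) (n : ℕ) : ℕ :=
  Nat.findGreatest (DecPrefix w) n

open Classical in
/-- The active sites after the initial run whose intermediate letters exceed the first letter. -/
noncomputable def highSites (w : ℕ → ℕ) (n : ℕ) : Finset ℕ :=
  (Finset.range (n + 1)).filter fun p => AscSite w n p ∧ AboveFirst w p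

open Classical in
/-- The remaining active sites after the initial run. -/
noncomputable def lowSites (w : ℕ → ℕ) (n : ℕ) : Finset ℕ :=
  (Finset.range (n + 1)).filter fun p => AscSite w n p ∧ ¬AboveFirst w p

variable {w : ℕ → ℕ} {n p : ℕ}

theorem mem_highSites : p ∈ highSites w n ↔ AscSite w n p ∧ AboveFirst w p := by
  simp only [highSites, Finset.mem_filter, Finset.mem_range, and_iff_right_iff_imp]
  exact fun h => Nat.lt_succ_of_le h.1.1

theorem mem_lowSites : p ∈ lowSites w n ↔ AscSite w n p ∧ ¬AboveFirst w p := by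
  simp only [lowSites, Finset.mem_filter, Finset.mem_range, and_iff_right_iff_imp]
  exact fun h => Nat.lt_succ_of_le h.1.1

theorem decRun_le : decRun w n ≤ n := by
  classical
  exact Nat.findGreatest_le n

theorem decPrefix_decRun : DecPrefix w (decRun w n) := by
  classical
  exact Nat.findGreatest_spec (P := DecPrefix w) (Nat.zero_le n) fun i j _ hj => by omega

theorem decPrefix_iff_le_decRun (hp : p ≤ n) : DecPrefix w p ↔ p ≤ decRun w n := by
  classical
  exact ⟨fun h => Nat.le_findGreatest hp h, fun h => decPrefix_decRun.mono h⟩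

theorem decRun_eq_of (h : ∀ p ≤ n, DecPrefix w p ↔ p ≤ m) (hm : m ≤ n) : decRun w n = m :=
  le_antisymm ((h _ decRun_le).1 decPrefix_decRun)
    ((decPrefix_iff_le_decRun hm).1 ((h m hm).2 le_rfl))

theorem decRun_pos (hn : 0 < n) : 0 < decRun w n :=
  (decPrefix_iff_le_decRun hn).1 fun i j hij hj => by omega

theorem decRun_insertMax_zero (hw : IsPermWord w n) :
    decRun (insertMax w n 0) (n + 1) = decRun w n + 1 := by
  refine decRun_eq_of (fun p hp => ?_) (Nat.succ_le_succ decRun_le)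
  rcases p with _ | p
  · exact ⟨fun _ => Nat.zero_le _, fun _ i j _ hj => by omega⟩
  · rw [decPrefix_insertMax_zero hw (by omega), decPrefix_iff_le_decRun (n := n) (by omega)]
    omega

theorem decRun_insertMax (hw : IsPermWord w n) (hp0 : 0 < p) (hp : p ≤ n) :
    decRun (insertMax w n p) (n + 1) = min p (decRun w n) := by
  refine decRun_eq_of (fun q hq => ?_) (by omega)
  by_cases hqp : q ≤ p
  · rw [decPrefix_insertMax_of_le hqp, decPrefix_iff_le_decRun (n := n) (by omega)]
    omega
  · obtain ⟨q, rfl⟩ := Nat.exists_eq_succ_of_ne_zero (show q ≠ 0 by omega)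
    have := not_decPrefix_insertMax hw hp0 hp (show p ≤ q by omega)
    rw [Nat.succ_eq_add_one] at *
    constructor
    · exact fun h => absurd h this
    · omega

/-- A linear statistic of the label (initial run, number of high sites, number of low sites). -/
noncomputable def siteWeight (α β γ : ℕ → ℕ) (w : ℕ → ℕ) (n : ℕ) : ℕ :=
  α (decRun w n) + (highSites w n).card * β (decRun w n) + (lowSites w n).card * γ (decRun w n)

/-- The run grows by one, and every later active site survives but becomes low. -/
theorem siteWeight_insertMax_zero (α β γ : ℕ → ℕ) (hw : IsPermWord w n) :
    siteWeight α β γ (insertMax w n 0) (n + 1) =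
      α (decRun w n + 1) + ((highSites w n).card + (lowSites w n).card) * γ (decRun w n + 1) := by
  have hH : highSites (insertMax w n 0) (n + 1) = ∅ := by
    ext q
    simp only [mem_highSites, Finset.notMem_empty, iff_false, not_and]
    exact not_aboveFirst_insertMax_zero hw
  have hL : lowSites (insertMax w n 0) (n + 1) =
      (highSites w n ∪ lowSites w n).map ⟨Nat.succ, Nat.succ_injective⟩ := by
    ext q
    simp only [mem_lowSites, Finset.mem_map, Finset.mem_union, mem_highSites,
      Function.Embedding.coeFn_mk]
    constructor
    · rintro ⟨h, -⟩
      obtain ⟨q, rfl, h⟩ := (ascSite_insertMax_zero hw).1 h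
      exact ⟨q, by tauto, rfl⟩
    · rintro ⟨q, h, rfl⟩
      have h' : AscSite (insertMax w n 0) (n + 1) (q + 1) :=
        (ascSite_insertMax_zero hw).2 ⟨q, rfl, by tauto⟩
      exact ⟨h', not_aboveFirst_insertMax_zero hw h'⟩
  have hdisj : Disjoint (highSites w n) (lowSites w n) := by
    rw [Finset.disjoint_left]
    intro q h1 h2
    exact (mem_lowSites.1 h2).2 (mem_highSites.1 h1).2
  rw [siteWeight, hH, hL, decRun_insertMax_zero hw, Finset.card_map,
    Finset.card_union_of_disjoint hdisj]
  simp

theorem siteWeight_insertMax_high (α β γ : ℕ → ℕ) (hw : IsPermWord w n)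
    (h : p ∈ highSites w n) :
    siteWeight α β γ (insertMax w n p) (n + 1) = α (decRun w n) + β (decRun w n) := by
  rw [mem_highSites] at h
  obtain ⟨hs, hab⟩ := h
  have hp : p ≤ n := hs.1
  have hlt : decRun w n < p := by
    by_contra! hc
    exact hs.2.1 ((decPrefix_iff_le_decRun hp).2 hc)
  have hH : highSites (insertMax w n p) (n + 1) = {p + 1} := by
    ext q
    rw [mem_highSites, ascSite_insertMax_of_ascSite hw hs, Finset.mem_singleton]
    refine ⟨fun h => h.1, ?_⟩
    rintro rfl
    exact ⟨rfl, (aboveFirst_insertMax hw (by omega) hp le_rfl fun k h1 h2 => by omega).2 hab⟩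
  have hL : lowSites (insertMax w n p) (n + 1) = ∅ := by
    ext q
    rw [mem_lowSites, ascSite_insertMax_of_ascSite hw hs]
    simp only [Finset.notMem_empty, iff_false, not_and, not_not]
    rintro rfl
    exact (aboveFirst_insertMax hw (by omega) hp le_rfl fun k h1 h2 => by omega).2 hab
  rw [siteWeight, hH, hL, decRun_insertMax hw (by omega) hp, min_eq_right hlt.le]
  simp

theorem siteWeight_insertMax_low (α β γ : ℕ → ℕ) (hw : IsPermWord w n)
    (h : p ∈ lowSites w n) :
    siteWeight α β γ (insertMax w n p) (n + 1) = α (decRun w n) + γ (decRun w n) := by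
  rw [mem_lowSites] at h
  obtain ⟨hs, hab⟩ := h
  have hp : p ≤ n := hs.1
  have hlt : decRun w n < p := by
    by_contra! hc
    exact hs.2.1 ((decPrefix_iff_le_decRun hp).2 hc)
  have key : ¬AboveFirst (insertMax w n p) (p + 1) := by
    rwa [aboveFirst_insertMax hw (by omega) hp le_rfl fun k h1 h2 => by omega]
  have hL : lowSites (insertMax w n p) (n + 1) = {p + 1} := by
    ext q
    rw [mem_lowSites, ascSite_insertMax_of_ascSite hw hs, Finset.mem_singleton]
    refine ⟨fun h => h.1, ?_⟩
    rintro rfl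
    exact ⟨rfl, key⟩
  have hH : highSites (insertMax w n p) (n + 1) = ∅ := by
    ext q
    rw [mem_highSites, ascSite_insertMax_of_ascSite hw hs]
    simp only [Finset.notMem_empty, iff_false, not_and]
    rintro rfl
    exact key
  rw [siteWeight, hH, hL, decRun_insertMax hw (by omega) hp, min_eq_right hlt.le]
  simp

theorem aboveFirst_of_ascSite_insertMax (hw : IsPermWord w n) (hp0 : 0 < p) (hp : p ≤ n)
    (hd : DecPrefix w p) {q : ℕ} (h : AscSite (insertMax w n p) (n + 1) q) :
    AboveFirst (insertMax w n p) q := by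
  obtain ⟨q, rfl, hpq, hq, -, hab⟩ := (ascSite_insertMax_of_pos hw hp0 hp).1 h
  exact (aboveFirst_insertMax hw hp0 hp hpq fun k h1 h2 => hab 0 k hp0 h1 h2).2 hd.aboveFirst

theorem lowSites_insertMax_of_decPrefix (hw : IsPermWord w n) (hp0 : 0 < p) (hp : p ≤ n)
    (hd : DecPrefix w p) : lowSites (insertMax w n p) (n + 1) = ∅ := by
  ext q
  simp only [mem_lowSites, Finset.notMem_empty, iff_false, not_and, not_not]
  exact aboveFirst_of_ascSite_insertMax hw hp0 hp hd

/-- Cutting the run strictly inside leaves a letter below the first one right after the inserted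
maximum, so only the site next to that maximum survives. -/
theorem siteWeight_insertMax_of_lt (α β γ : ℕ → ℕ) (hw : IsPermWord w n) (hp0 : 0 < p)
    (h : p < decRun w n) :
    siteWeight α β γ (insertMax w n p) (n + 1) = α p + β p := by
  have hr : decRun w n ≤ n := decRun_le
  have hp : p ≤ n := by omega
  have hd : DecPrefix w p := decPrefix_decRun.mono h.le
  have hH : highSites (insertMax w n p) (n + 1) = {p + 1} := by
    ext q
    rw [mem_highSites, Finset.mem_singleton]
    have := ascSite_insertMax_of_decPrefix hw hp0 hp hd (q := q)
    constructor
    · rintro ⟨h1, -⟩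
      rcases this.1 h1 with h2 | ⟨q, -, h2, -⟩
      · exact h2
      · exact absurd (decPrefix_decRun.mono h) h2
    · intro h1
      exact ⟨this.2 (Or.inl h1),
        aboveFirst_of_ascSite_insertMax hw hp0 hp hd (this.2 (Or.inl h1))⟩
  rw [siteWeight, hH, lowSites_insertMax_of_decPrefix hw hp0 hp hd, decRun_insertMax hw hp0 hp,
    min_eq_left h.le]
  simp

/-- Insertion at the end of the run keeps exactly the high sites and adds the site after the
maximum; all of them are high. -/
theorem siteWeight_insertMax_decRun (α β γ : ℕ → ℕ) (hw : IsPermWord w n) (hn : 0 < n) :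
    siteWeight α β γ (insertMax w n (decRun w n)) (n + 1) =
      α (decRun w n) + ((highSites w n).card + 1) * β (decRun w n) := by
  set p := decRun w n with hpdef
  have hp0 : 0 < p := decRun_pos hn
  have hp : p ≤ n := decRun_le
  have hd : DecPrefix w p := decPrefix_decRun
  have hnd : ∀ q, AscSite w n q → p < q ∧ ¬DecPrefix w (p + 1) := by
    intro q hq
    have h1 : p < q := by
      by_contra! hc
      exact hq.2.1 (hd.mono hc)
    have h2 := hq.1
    rw [decPrefix_iff_le_decRun (n := n) (by omega)]
    omega
  have hH : highSites (insertMax w n p) (n + 1) =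
      insert (p + 1) ((highSites w n).map ⟨Nat.succ, Nat.succ_injective⟩) := by
    ext q
    rw [mem_highSites, Finset.mem_insert, Finset.mem_map]
    have := ascSite_insertMax_of_decPrefix hw hp0 hp hd (q := q)
    constructor
    · rintro ⟨h1, -⟩
      rcases this.1 h1 with h2 | ⟨q, rfl, -, h2⟩
      · exact Or.inl h2
      · exact Or.inr ⟨q, mem_highSites.2 h2, rfl⟩
    · intro h1
      have h2 : AscSite (insertMax w n p) (n + 1) q := by
        rcases h1 with h1 | ⟨q, h1, rfl⟩
        · exact this.2 (Or.inl h1)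
        · have h1 := mem_highSites.1 h1
          exact this.2 (Or.inr ⟨q, rfl, (hnd q h1.1).2, h1⟩)
      exact ⟨h2, aboveFirst_of_ascSite_insertMax hw hp0 hp hd h2⟩
  rw [siteWeight, hH, lowSites_insertMax_of_decPrefix hw hp0 hp hd, decRun_insertMax hw hp0 hp,
    ← hpdef, min_self, Finset.card_insert_of_notMem, Finset.card_map]
  · simp
  · rw [Finset.mem_map]
    rintro ⟨q, hq, he⟩
    have := (hnd q (mem_highSites.1 hq).1).1
    simp only [Function.Embedding.coeFn_mk] at he
    omega

-- Summing the weights of all children of a label gives a statistic of the same linear form: this is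
-- the transpose of the succession rule.
open Classical in
theorem sum_siteWeight_insertMax (α β γ : ℕ → ℕ) (hw : IsPermWord w n) (hn : 0 < n) :
    ∑ p ∈ (Finset.range (n + 1)).filter (ActiveSite w n),
        siteWeight α β γ (insertMax w n p) (n + 1) =
      siteWeight (fun r => α (r + 1) + ∑ x ∈ Finset.range r, (α (x + 1) + β (x + 1)))
        (fun r => γ (r + 1) + 2 * β r + α r) (fun r => γ (r + 1) + α r + γ r) w n := by
  have hr : decRun w n ≤ n := decRun_le
  have hr0 := decRun_pos (w := w) hn
  have hsplit : (Finset.range (n + 1)).filter (ActiveSite w n) =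
      Finset.range (decRun w n + 1) ∪ (highSites w n ∪ lowSites w n) := by
    ext q
    simp only [Finset.mem_filter, Finset.mem_range, Finset.mem_union, mem_highSites, mem_lowSites]
    constructor
    · rintro ⟨h1, h2⟩
      by_cases hd : DecPrefix w q
      · have := (decPrefix_iff_le_decRun (n := n) (by omega)).1 hd
        omega
      · have : AscSite w n q := ⟨by omega, hd, h2⟩
        tauto
    · rintro (h | h)
      · exact ⟨by omega, (decPrefix_decRun.mono (Nat.lt_succ_iff.1 h)).activeSite⟩
      · have h' : AscSite w n q := by tauto
        exact ⟨Nat.lt_succ_of_le h'.1, h'.2.2⟩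
  have hdisj : Disjoint (highSites w n) (lowSites w n) := by
    rw [Finset.disjoint_left]
    intro q h1 h2
    exact (mem_lowSites.1 h2).2 (mem_highSites.1 h1).2
  have hdisj' : Disjoint (Finset.range (decRun w n + 1)) (highSites w n ∪ lowSites w n) := by
    rw [Finset.disjoint_left]
    intro q h1 h2
    simp only [Finset.mem_range, Finset.mem_union, mem_highSites, mem_lowSites] at h1 h2
    have h' : AscSite w n q := by tauto
    exact h'.2.1 (decPrefix_decRun.mono (Nat.lt_succ_iff.1 h1))
  rw [hsplit, Finset.sum_union hdisj', Finset.sum_union hdisj,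
    Finset.sum_congr rfl fun p hp => siteWeight_insertMax_high α β γ hw hp,
    Finset.sum_congr rfl fun p hp => siteWeight_insertMax_low α β γ hw hp,
    Finset.sum_range_succ, siteWeight_insertMax_decRun α β γ hw hn]
  -- The sum on the right also has the term for the full run length, which is supplied by insertion
  -- at the end of the run; adding it on the left avoids natural subtraction.
  have hrun : ∑ p ∈ Finset.range (decRun w n),
      siteWeight α β γ (insertMax w n p) (n + 1) + (α (decRun w n) + β (decRun w n)) =
      α (decRun w n + 1) + ((highSites w n).card + (lowSites w n).card) * γ (decRun w n + 1) +
        ∑ x ∈ Finset.range (decRun w n), (α (x + 1) + β (x + 1)) := by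
    obtain ⟨s, hs⟩ := Nat.exists_eq_succ_of_ne_zero hr0.ne'
    have hsum : ∑ p ∈ Finset.range s, siteWeight α β γ (insertMax w n (p + 1)) (n + 1) =
        ∑ x ∈ Finset.range s, (α (x + 1) + β (x + 1)) := by
      refine Finset.sum_congr rfl fun p hp => ?_
      rw [Finset.mem_range] at hp
      exact siteWeight_insertMax_of_lt α β γ hw (Nat.succ_pos p) (by omega)
    rw [hs, Nat.succ_eq_add_one, Finset.sum_range_succ', hsum, Finset.sum_range_succ,
      siteWeight_insertMax_zero α β γ hw, hs]
    simp only [Nat.succ_eq_add_one]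
    ring
  generalize ∑ p ∈ Finset.range (decRun w n), siteWeight α β γ (insertMax w n p) (n + 1) = S
    at hrun ⊢
  simp only [siteWeight, Finset.sum_const, smul_eq_mul]
  linear_combination hrun

end SiteCounts

/-! ### From permutations to words -/

section PermWord

variable {n : ℕ}

/-- The one-line notation of a permutation, extended by zero. -/
def permWord (σ : Equiv.Perm (Fin n)) (m : ℕ) : ℕ :=
  if h : m < n then σ ⟨m, h⟩ else 0

theorem permWord_of_lt (σ : Equiv.Perm (Fin n)) {m : ℕ} (h : m < n) :
    permWord σ m = σ ⟨m, h⟩ := by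
  simp [permWord, h]

theorem permWord_val (σ : Equiv.Perm (Fin n)) (i : Fin n) : permWord σ i = σ i :=
  permWord_of_lt σ i.2

theorem isPermWord_permWord (σ : Equiv.Perm (Fin n)) : IsPermWord (permWord σ) n := by
  refine ⟨fun i hi => ?_, fun i hi j hj h => ?_⟩
  · rw [permWord_of_lt σ hi]
    exact (σ _).2
  · rw [permWord_of_lt σ hi, permWord_of_lt σ hj] at h
    simpa using σ.injective (Fin.ext h)

theorem permContains_four_iff (σ : Equiv.Perm (Fin n)) (τ : Equiv.Perm (Fin 4)) :
    PermContains σ τ ↔ ∃ e : Fin 4 → ℕ, StrictMono e ∧ (∀ i, e i < n) ∧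
      ∀ i j, permWord σ (e i) < permWord σ (e j) ↔ τ i < τ j := by
  constructor
  · rintro ⟨e, he⟩
    refine ⟨fun i => e i, fun i j h => e.strictMono h, fun i => (e i).2, fun i j => ?_⟩
    rw [permWord_val, permWord_val, ← he i j, Fin.lt_def]
  · rintro ⟨e, hm, hn, he⟩
    refine ⟨OrderEmbedding.ofStrictMono (fun i => ⟨e i, hn i⟩) fun i j h => hm h, fun i j => ?_⟩
    rw [← he i j, permWord_of_lt σ (hn i), permWord_of_lt σ (hn j), ← Fin.lt_def]
    rfl

theorem permContains_1243_iff (σ : Equiv.Perm (Fin n)) :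
    PermContains σ perm1243 ↔ ∃ i j k l, i < j ∧ j < k ∧ k < l ∧ l < n ∧
      permWord σ i < permWord σ j ∧ permWord σ j < permWord σ l ∧
        permWord σ l < permWord σ k := by
  rw [permContains_four_iff]
  constructor
  · rintro ⟨e, hm, hn, he⟩
    exact ⟨e 0, e 1, e 2, e 3, hm (by decide), hm (by decide), hm (by decide), hn 3,
      (he 0 1).2 (by decide), (he 1 3).2 (by decide), (he 3 2).2 (by decide)⟩
  · rintro ⟨i, j, k, l, hij, hjk, hkl, hl, h1, h2, h3⟩
    refine ⟨![i, j, k, l], ?_, ?_, ?_⟩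
    · intro a b hab
      fin_cases a <;> fin_cases b <;> simp at hab ⊢ <;> omega
    · intro a
      fin_cases a <;> simp <;> omega
    · intro a b
      fin_cases a <;> fin_cases b <;> simp [perm1243] <;> omega

theorem permContains_2314_iff (σ : Equiv.Perm (Fin n)) :
    PermContains σ perm2314 ↔ ∃ i j k l, i < j ∧ j < k ∧ k < l ∧ l < n ∧
      permWord σ k < permWord σ i ∧ permWord σ i < permWord σ j ∧
        permWord σ j < permWord σ l := by
  rw [permContains_four_iff]
  constructor
  · rintro ⟨e, hm, hn, he⟩
    exact ⟨e 0, e 1, e 2, e 3, hm (by decide), hm (by decide), hm (by decide), hn 3,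
      (he 2 0).2 (by decide), (he 0 1).2 (by decide), (he 1 3).2 (by decide)⟩
  · rintro ⟨i, j, k, l, hij, hjk, hkl, hl, h1, h2, h3⟩
    refine ⟨![i, j, k, l], ?_, ?_, ?_⟩
    · intro a b hab
      fin_cases a <;> fin_cases b <;> simp at hab ⊢ <;> omega
    · intro a
      fin_cases a <;> simp <;> omega
    · intro a b
      fin_cases a <;> fin_cases b <;> simp [perm2314] <;> omega

theorem mem_classE_iff (σ : Equiv.Perm (Fin n)) :
    σ ∈ classE n ↔ 0 < n ∧ WordAvoids (permWord σ) n := by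
  have : σ ∈ classE n ↔ 0 < n ∧ ¬PermContains σ perm1243 ∧ ¬PermContains σ perm2314 := by
    simp [classE, permAv]
  rw [this, permContains_1243_iff, permContains_2314_iff]
  refine and_congr_right fun _ => ⟨?_, ?_⟩
  · rintro ⟨h1, h2⟩ i j k l hij hjk hkl hl
    exact ⟨fun h => h1 ⟨i, j, k, l, hij, hjk, hkl, hl, h⟩,
      fun h => h2 ⟨i, j, k, l, hij, hjk, hkl, hl, h⟩⟩
  · intro h
    constructor
    · rintro ⟨i, j, k, l, hij, hjk, hkl, hl, hc⟩
      exact (h i j k l hij hjk hkl hl).1 hc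
    · rintro ⟨i, j, k, l, hij, hjk, hkl, hl, hc⟩
      exact (h i j k l hij hjk hkl hl).2 hc

/-- Insert a new maximum into a permutation at site `p`. -/
def permInsertMax (σ : Equiv.Perm (Fin n)) (p : Fin (n + 1)) : Equiv.Perm (Fin (n + 1)) :=
  ((finSuccEquiv' p).trans (Equiv.optionCongr σ)).trans (finSuccEquiv' (Fin.last n)).symm

theorem permInsertMax_self (σ : Equiv.Perm (Fin n)) (p : Fin (n + 1)) :
    permInsertMax σ p p = Fin.last n := by
  simp [permInsertMax]

theorem permInsertMax_succAbove (σ : Equiv.Perm (Fin n)) (p : Fin (n + 1)) (i : Fin n) :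
    permInsertMax σ p (p.succAbove i) = (σ i).castSucc := by
  simp [permInsertMax]

theorem permInsertMax_bijective :
    Function.Bijective fun x : Equiv.Perm (Fin n) × Fin (n + 1) => permInsertMax x.1 x.2 := by
  rw [Fintype.bijective_iff_injective_and_card]
  constructor
  · rintro ⟨σ, p⟩ ⟨τ, q⟩ h
    simp only at h
    have hpq : p = q := by
      have h1 := permInsertMax_self σ p
      rw [h, ← permInsertMax_self τ q] at h1
      exact (permInsertMax τ q).injective h1
    subst hpq
    have hστ : σ = τ := by
      ext i
      have := congrArg (fun f => f (p.succAbove i)) h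
      simp only [permInsertMax_succAbove] at this
      rw [Fin.castSucc_injective n this]
    rw [hστ]
  · simp [Fintype.card_perm, Nat.factorial_succ, mul_comm]

theorem permWord_permInsertMax (σ : Equiv.Perm (Fin n)) (p : Fin (n + 1)) {m : ℕ}
    (hm : m < n + 1) :
    permWord (permInsertMax σ p) m = insertMax (permWord σ) n p m := by
  rw [permWord_of_lt _ hm]
  rcases Fin.eq_self_or_eq_succAbove p ⟨m, hm⟩ with h | ⟨i, h⟩
  · rw [h, permInsertMax_self, ← h, insertMax_self, Fin.val_last]
  · rw [h, permInsertMax_succAbove, Fin.val_castSucc, ← permWord_val]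
    have hv : m = (p.succAbove i : ℕ) := congrArg Fin.val h
    rcases lt_or_ge i.castSucc p with hc | hc
    · rw [Fin.succAbove_of_castSucc_lt _ _ hc, Fin.val_castSucc] at hv
      have hc' : (i : ℕ) < p := hc
      rw [hv, insertMax_of_lt hc']
    · rw [Fin.succAbove_of_le_castSucc _ _ hc, Fin.val_succ] at hv
      have hc' : (p : ℕ) ≤ i := hc
      rw [hv, insertMax_succ hc']

section Congr

variable {v w : ℕ → ℕ} {p : ℕ}

theorem DecPrefix.congr (h : ∀ m < n, v m = w m) (hp : p ≤ n) :
    DecPrefix v p ↔ DecPrefix w p := by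
  refine forall₄_congr fun i j hij hj => ?_
  rw [h i (by omega), h j (by omega)]

theorem WordAvoids.congr (h : ∀ m < n, v m = w m) : WordAvoids v n ↔ WordAvoids w n := by
  refine forall₄_congr fun i j k l => forall₄_congr fun hij hjk hkl hl => ?_
  rw [h i (by omega), h j (by omega), h k (by omega), h l (by omega)]

theorem AscSite.congr (h : ∀ m < n, v m = w m) : AscSite v n p ↔ AscSite w n p := by
  refine and_congr_right fun hp => and_congr (not_congr (DecPrefix.congr h hp)) (and_congr ?_ ?_)
  · refine forall₃_congr fun i j k => forall₄_congr fun hij hj hk hkn => ?_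
    rw [h i (by omega), h j (by omega), h k (by omega)]
  · refine forall₃_congr fun i j k => forall₃_congr fun hij hj hk => ?_
    rw [h i (by omega), h j (by omega), h k (by omega)]

theorem AboveFirst.congr (h : ∀ m < n, v m = w m) (hp : p ≤ n) :
    AboveFirst v p ↔ AboveFirst w p := by
  refine forall₂_congr fun m hm => ?_
  rw [h m (by omega), h 0 (by omega), DecPrefix.congr h (by omega)]

/-- Labels read only the first `n` letters, so the zero padding in `permWord` is harmless. -/
theorem siteWeight_congr (α β γ : ℕ → ℕ) (h : ∀ m < n, v m = w m) :
    siteWeight α β γ v n = siteWeight α β γ w n := by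
  have h1 : decRun v n = decRun w n :=
    decRun_eq_of (fun p hp => by rw [DecPrefix.congr h hp, decPrefix_iff_le_decRun hp]) decRun_le
  have h2 : highSites v n = highSites w n := by
    ext q
    rw [mem_highSites, mem_highSites, AscSite.congr h]
    exact and_congr_right fun hq => AboveFirst.congr h hq.1
  have h3 : lowSites v n = lowSites w n := by
    ext q
    rw [mem_lowSites, mem_lowSites, AscSite.congr h]
    exact and_congr_right fun hq => not_congr (AboveFirst.congr h hq.1)
  rw [siteWeight, siteWeight, h1, h2, h3]

end Congr

open Classical in
/-- The total weight of the permutations of length `n` in the class. -/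
noncomputable def classWeight (α β γ : ℕ → ℕ) (n : ℕ) : ℕ :=
  ∑ σ : Equiv.Perm (Fin n), if WordAvoids (permWord σ) n then siteWeight α β γ (permWord σ) n else 0

/-- Each permutation of length `n + 1` arises from exactly one pair of a shorter permutation and a
site, so the sum splits over parents. -/
theorem classWeight_succ (α β γ : ℕ → ℕ) (hn : 0 < n) :
    classWeight α β γ (n + 1) =
      classWeight (fun r => α (r + 1) + ∑ x ∈ Finset.range r, (α (x + 1) + β (x + 1)))
        (fun r => γ (r + 1) + 2 * β r + α r) (fun r => γ (r + 1) + α r + γ r) n := by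
  classical
  rw [classWeight, ← Function.Bijective.sum_comp permInsertMax_bijective, Fintype.sum_prod_type,
    classWeight]
  refine Finset.sum_congr rfl fun σ _ => ?_
  have hw := isPermWord_permWord σ
  have key : ∀ p : Fin (n + 1),
      (if WordAvoids (permWord (permInsertMax σ p)) (n + 1)
        then siteWeight α β γ (permWord (permInsertMax σ p)) (n + 1) else 0) =
      if WordAvoids (permWord σ) n ∧ ActiveSite (permWord σ) n p
        then siteWeight α β γ (insertMax (permWord σ) n p) (n + 1) else 0 := by
    intro p
    have h := fun m (hm : m < n + 1) => permWord_permInsertMax σ p hm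
    simp only [WordAvoids.congr h, wordAvoids_insertMax hw (Nat.lt_succ_iff.1 p.2),
      siteWeight_congr α β γ h]
  simp only [key]
  rw [Fin.sum_univ_eq_sum_range (fun p => if WordAvoids (permWord σ) n ∧
    ActiveSite (permWord σ) n p then siteWeight α β γ (insertMax (permWord σ) n p) (n + 1) else 0)]
  split_ifs with hav
  · simp only [hav, true_and]
    rw [← Finset.sum_filter, sum_siteWeight_insertMax α β γ hw hn]
  · simp [hav]

theorem classWeight_one (α β γ : ℕ → ℕ) : classWeight α β γ 1 = α 1 := by
  have hd : ∀ (w : ℕ → ℕ) (p : ℕ), p ≤ 1 → DecPrefix w p := fun w p hp i j hij hj => by omega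
  have hr : ∀ w : ℕ → ℕ, decRun w 1 = 1 := fun w =>
    decRun_eq_of (fun p hp => ⟨fun _ => hp, fun _ => hd w p hp⟩) le_rfl
  have hA : ∀ (w : ℕ → ℕ) (p : ℕ), ¬AscSite w 1 p := fun w p h => h.2.1 (hd w p h.1)
  have hH : ∀ w : ℕ → ℕ, highSites w 1 = ∅ := fun w => by
    ext q
    simp [mem_highSites, hA]
  have hL : ∀ w : ℕ → ℕ, lowSites w 1 = ∅ := fun w => by
    ext q
    simp [mem_lowSites, hA]
  have hav : ∀ w : ℕ → ℕ, WordAvoids w 1 := fun w i j k l hij hjk hkl hl => by omega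
  simp [classWeight, siteWeight, hr, hH, hL, hav]

theorem card_classE_eq_classWeight (hn : 0 < n) :
    Nat.card (classE n) = classWeight (fun _ => 1) (fun _ => 0) (fun _ => 0) n := by
  classical
  rw [Nat.card_eq_fintype_card, Fintype.card_subtype, Finset.card_filter, classWeight]
  refine Finset.sum_congr rfl fun σ _ => ?_
  simp [mem_classE_iff, hn, siteWeight]

theorem card_classE_zero : Nat.card (classE 0) = 0 := by
  have : classE 0 = ∅ := by
    ext σ
    simp [mem_classE_iff]
  simp [this]

end PermWord

/-! ### Counting by the transposed operator -/

/-- Iterates of the succession operator on linear statistics, starting from the constant `1`. -/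
def labelWeight : ℕ → (ℕ → ℕ) × (ℕ → ℕ) × (ℕ → ℕ)
  | 0 => (fun _ => 1, fun _ => 0, fun _ => 0)
  | n + 1 =>
    let t := labelWeight n
    (fun r => t.1 (r + 1) + ∑ x ∈ Finset.range r, (t.1 (x + 1) + t.2.1 (x + 1)),
      fun r => t.2.2 (r + 1) + 2 * t.2.1 r + t.1 r, fun r => t.2.2 (r + 1) + t.1 r + t.2.2 r)

/-- Each application of the operator removes one letter; at length 1 only the label `(1, 0, 0)` is
left. -/
theorem card_classE_add (n k : ℕ) : Nat.card (classE (n + k + 1)) =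
    classWeight (labelWeight k).1 (labelWeight k).2.1 (labelWeight k).2.2 (n + 1) := by
  induction k generalizing n with
  | zero => exact card_classE_eq_classWeight (Nat.succ_pos n)
  | succ k ih =>
    rw [show n + (k + 1) + 1 = (n + 1) + k + 1 by omega, ih (n + 1),
      classWeight_succ _ _ _ (Nat.succ_pos n)]
    rfl

theorem card_classE_succ (k : ℕ) : Nat.card (classE (k + 1)) = (labelWeight k).1 1 := by
  have := card_classE_add 0 k
  rwa [Nat.zero_add, Nat.zero_add, classWeight_one] at this

/-! ### The kernel equation and the cubic -/

section Series

open PowerSeries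

/-- Banach's fixed point argument in the `X`-adic metric. -/
theorem PowerSeries.exists_fixedPoint {R : Type*} [CommRing R] (Φ : PowerSeries R → PowerSeries R)
    (hΦ : ∀ f g n, (X : PowerSeries R) ^ n ∣ f - g → (X : PowerSeries R) ^ (n + 1) ∣ Φ f - Φ g) :
    ∃ f, Φ f = f := by
  have hstep : ∀ n, (X : PowerSeries R) ^ n ∣ Φ^[n + 1] 0 - Φ^[n] 0 := by
    intro n
    induction n with
    | zero => simp
    | succ n ih =>
      rw [Function.iterate_succ_apply' Φ (n + 1), Function.iterate_succ_apply' Φ n]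
      rw [Function.iterate_succ_apply' Φ n] at ih
      exact hΦ _ _ _ ih
  have hcoeff : ∀ m k, coeff m (Φ^[m + 1 + k] 0) = coeff m (Φ^[m + 1] 0) := by
    intro m k
    induction k with
    | zero => rfl
    | succ k ih =>
      rw [← ih, ← sub_eq_zero, ← map_sub]
      exact X_pow_dvd_iff.1 (hstep (m + 1 + k)) m (by omega)
  -- Coefficient `m` is stable from iterate `m + 1` on, so the diagonal is the limit.
  let f : PowerSeries R := PowerSeries.mk fun m => coeff m (Φ^[m + 1] 0)
  have hf : ∀ n, (X : PowerSeries R) ^ n ∣ f - Φ^[n] 0 := by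
    intro n
    rw [X_pow_dvd_iff]
    intro m hm
    obtain ⟨k, rfl⟩ := Nat.exists_eq_add_of_le (Nat.succ_le_of_lt hm)
    rw [map_sub, coeff_mk, sub_eq_zero]
    exact (hcoeff m k).symm
  refine ⟨f, ?_⟩
  ext m
  have h1 := hΦ _ _ _ (hf m)
  rw [← Function.iterate_succ_apply' Φ m] at h1
  have h2 := dvd_sub h1 (hf (m + 1))
  rw [sub_sub_sub_cancel_right] at h2
  have := X_pow_dvd_iff.1 h2 m (by omega)
  rwa [map_sub, sub_eq_zero] at this

variable {𝕜 : Type*} [Field 𝕜]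

/-- `E` is `X/(1-2X)` and `K` is `1/(1-X-XL)`; inserting `K` as a function of `L` leaves one
contracting equation. Keeping `E` and `K` as unknowns gives a system with nonnegative coefficients,
which the growth estimates need. -/
theorem exists_series_system : ∃ L E K : PowerSeries 𝕜,
    L = 1 + X * (L ^ 2 + X * ((1 + E) * L * K)) ∧ E = X * (1 + 2 * E) ∧
      K = 1 + X * ((1 + L) * K) := by
  obtain ⟨E, hE⟩ : ∃ E : PowerSeries 𝕜, E = X * (1 + 2 * E) := by
    refine ⟨X * (1 - 2 * X)⁻¹, ?_⟩
    have := PowerSeries.mul_inv_cancel (1 - 2 * X : PowerSeries 𝕜) (by simp)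
    linear_combination X * this
  have hK : ∀ f : PowerSeries 𝕜, (1 - X * (1 + f)) * (1 - X * (1 + f))⁻¹ = 1 := fun f =>
    PowerSeries.mul_inv_cancel _ (by simp)
  generalize hKdef : (fun f : PowerSeries 𝕜 => (1 - X * (1 + f))⁻¹) = K at hK
  replace hK : ∀ f, (1 - X * (1 + f)) * K f = 1 := fun f => by rw [← hKdef]; exact hK f
  obtain ⟨L, hL⟩ := PowerSeries.exists_fixedPoint
    (fun f => 1 + X * (f ^ 2 + X * ((1 + E) * f * K f))) (by
      rintro f g n ⟨d, hd⟩
      refine ⟨d * (f + g + X * (1 + E) * (K f + g * K f * K g * X)), ?_⟩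
      have hfg : K f - K g = K f * K g * X * (f - g) := by
        linear_combination K g * hK f - K f * hK g
      linear_combination X ^ 2 * (1 + E) * g * hfg +
        X * (f + g + X * (1 + E) * (K f + g * K f * K g * X)) * hd)
  exact ⟨L, E, K L, hL.symm, hE, by linear_combination hK L⟩

/-- The ansatz that each family is geometric in `r` with common ratio `L` satisfies the recurrences
of `labelWeight`, and these determine all coefficients. The shift to `r + 1` is there because runs
have length at least 1. -/
theorem labelWeight_eq_coeff {L E K C : PowerSeries 𝕜}
    (hL : L = 1 + X * (L ^ 2 + X * ((1 + E) * L * K))) (hE : E = X * (1 + 2 * E))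
    (hK : K = 1 + X * ((1 + L) * K)) (hC : C = L + X * L * C) (n r : ℕ) :
    ((labelWeight n).1 (r + 1) : 𝕜) = coeff n (C * L ^ r) ∧
    ((labelWeight n).2.1 (r + 1) : 𝕜) = coeff n (X * C * (1 + E) * K * L ^ r) ∧
    ((labelWeight n).2.2 (r + 1) : 𝕜) = coeff n (X * C * K * L ^ r) := by
  have hL0 : L ≠ 0 := by
    intro h
    have := congrArg constantCoeff hL
    simp [h] at this
  have hbase : C = 1 + X * (C * L + C + X * C * (1 + E) * K) := by
    refine mul_left_cancel₀ hL0 ?_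
    linear_combination hC + C * hL
  -- The difference of two consecutive instances is `C * L ^ r` times the equation for `L`, so only
  -- `r = 0` needs the definition of `C`.
  have hA : ∀ r, C * L ^ r = 1 + X * (C * L ^ (r + 1) +
      ∑ x ∈ Finset.range (r + 1), (C * L ^ x + X * C * (1 + E) * K * L ^ x)) := by
    intro r
    induction r with
    | zero =>
      simp only [zero_add, Finset.sum_range_one, pow_zero, pow_one, mul_one]
      linear_combination hbase
    | succ r ih =>
      rw [Finset.sum_range_succ]
      linear_combination ih + C * L ^ r * hL
  have hB : ∀ r, X * C * (1 + E) * K * L ^ r = X * (X * C * K * L ^ (r + 1) +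
      2 * (X * C * (1 + E) * K * L ^ r) + C * L ^ r) := by
    intro r
    linear_combination X * C * L ^ r * K * hE + X * C * L ^ r * hK
  have hG : ∀ r, X * C * K * L ^ r = X * (X * C * K * L ^ (r + 1) + C * L ^ r +
      X * C * K * L ^ r) := by
    intro r
    linear_combination X * C * L ^ r * hK
  induction n generalizing r with
  | zero =>
    refine ⟨?_, ?_, ?_⟩
    · rw [hA]
      simp [labelWeight]
    · rw [hB]
      simp [labelWeight]
    · rw [hG]
      simp [labelWeight]
  | succ n ih =>
    refine ⟨?_, ?_, ?_⟩
    · rw [hA, map_add, coeff_succ_X_mul, coeff_one, if_neg (Nat.succ_ne_zero n), map_add, map_sum,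
        ← (ih _).1, zero_add]
      simp only [map_add, ← (ih _).1, ← (ih _).2.1]
      simp [labelWeight]
    · rw [hB, coeff_succ_X_mul, map_add, map_add, two_mul, map_add, ← (ih _).2.2, ← (ih _).2.1,
        ← (ih _).1]
      simp [labelWeight, two_mul]
    · rw [hG, coeff_succ_X_mul, map_add, map_add, ← (ih _).2.2, ← (ih _).2.2, ← (ih _).1]
      simp [labelWeight]

variable (𝕜) in
/-- The generating function of the class with coefficients in `𝕜`. -/
noncomputable def classSeries : PowerSeries 𝕜 :=
  PowerSeries.mk fun n => (Nat.card (classE n) : 𝕜)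

theorem classSeries_eq {L E K : PowerSeries 𝕜}
    (hL : L = 1 + X * (L ^ 2 + X * ((1 + E) * L * K))) (hE : E = X * (1 + 2 * E))
    (hK : K = 1 + X * ((1 + L) * K)) : classSeries 𝕜 = X * L * (1 + classSeries 𝕜) := by
  obtain ⟨C, hC⟩ : ∃ C : PowerSeries 𝕜, C = L + X * L * C := by
    refine ⟨(1 - X * L)⁻¹ * L, ?_⟩
    have := PowerSeries.mul_inv_cancel (1 - X * L : PowerSeries 𝕜) (by simp)
    linear_combination L * this
  have h : classSeries 𝕜 = X * C := by
    ext n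
    rcases n with _ | n
    · rw [classSeries, coeff_mk, card_classE_zero]
      simp
    · have := (labelWeight_eq_coeff hL hE hK hC n 0).1
      rw [pow_zero, mul_one, zero_add, ← card_classE_succ] at this
      rw [coeff_succ_X_mul, ← this, classSeries, coeff_mk]
  rw [h]
  linear_combination X * hC

theorem classSeries_cubic :
    (X - 3 * X ^ 2 + 2 * X ^ 3 : PowerSeries 𝕜)
        - (1 - 5 * X + 8 * X ^ 2 - 5 * X ^ 3) * classSeries 𝕜
        + (2 * X - 5 * X ^ 2 + 4 * X ^ 3) * classSeries 𝕜 ^ 2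
        + X ^ 3 * classSeries 𝕜 ^ 3 = 0 := by
  obtain ⟨L, E, K, hL, hE, hK⟩ := exists_series_system (𝕜 := 𝕜)
  have hF := classSeries_eq hL hE hK
  generalize classSeries 𝕜 = F at hF ⊢
  -- `E`, `K` and `L` are eliminated after clearing denominators, using that `X * L` is `F/(1+F)`.
  have hE' : (1 + E) * (1 - 2 * X) = 1 - X := by linear_combination hE
  have hK' : K * ((1 - X) * (1 + F) - F) = 1 + F := by
    linear_combination (1 + F) * hK - K * hF
  have hL' : F * (1 + F) = X * (1 + F) ^ 2 + F ^ 2 + X ^ 2 * ((1 + E) * K * F * (1 + F)) := by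
    linear_combination X * (1 + F) ^ 2 * hL +
      ((1 + F) - (X * L * (1 + F) + F) - X ^ 2 * (1 + E) * K * (1 + F)) * hF
  linear_combination (-1) * (1 - 2 * X) * ((1 - X) * (1 + F) - F) * hL' -
    X ^ 2 * F * (1 + F) * K * ((1 - X) * (1 + F) - F) * hE' -
    X ^ 2 * F * (1 + F) * (1 - X) * hK'

/-- The cubic equation of the class as a polynomial over `ℚ[z]`. -/
noncomputable def classCubic : Polynomial (Polynomial ℚ) :=
  Polynomial.C (Polynomial.X - 3 * Polynomial.X ^ 2 + 2 * Polynomial.X ^ 3)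
    - Polynomial.C (1 - 5 * Polynomial.X + 8 * Polynomial.X ^ 2 - 5 * Polynomial.X ^ 3) *
      Polynomial.X
    + Polynomial.C (2 * Polynomial.X - 5 * Polynomial.X ^ 2 + 4 * Polynomial.X ^ 3) *
      Polynomial.X ^ 2
    + Polynomial.C (Polynomial.X ^ 3) * Polynomial.X ^ 3

theorem isAlgebraic_classSeries : IsAlgebraic (Polynomial ℚ) (classSeries ℚ) := by
  refine ⟨classCubic, ?_, ?_⟩
  · intro h
    -- The constant coefficient in `F` takes the value 6 at `z = 2`.
    have := congrArg (fun p => (p.eval 0).eval 2) h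
    norm_num [classCubic] at this
  · rw [← classSeries_cubic (𝕜 := ℚ)]
    have hcast : ∀ (k : ℕ) [k.AtLeastTwo],
        ((OfNat.ofNat k : Polynomial ℚ) : PowerSeries ℚ) = OfNat.ofNat k :=
      fun k _ => map_ofNat Polynomial.coeToPowerSeries.ringHom k
    simp [classCubic, PowerSeries.algebraMap_apply', hcast]

end Series

/-! ### Positive systems, convergence and root limits -/

section Growth

open PowerSeries Filter

/-- Power series with nonnegative coefficients. -/
def NonnegCoeffs (f : PowerSeries ℝ) : Prop :=
  ∀ n, 0 ≤ coeff n f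

namespace NonnegCoeffs

variable {f g : PowerSeries ℝ}

theorem add (hf : NonnegCoeffs f) (hg : NonnegCoeffs g) : NonnegCoeffs (f + g) := fun n => by
  rw [map_add]
  exact add_nonneg (hf n) (hg n)

theorem mul (hf : NonnegCoeffs f) (hg : NonnegCoeffs g) : NonnegCoeffs (f * g) := fun n => by
  rw [coeff_mul]
  exact Finset.sum_nonneg fun p _ => mul_nonneg (hf p.1) (hg p.2)

theorem one : NonnegCoeffs 1 := fun n => by
  rw [coeff_one]
  split_ifs <;> norm_num

theorem X : NonnegCoeffs X := fun n => by
  rw [coeff_X]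
  split_ifs <;> norm_num

end NonnegCoeffs

theorem coeff_mul_nonneg_of_le {f g : PowerSeries ℝ} {n : ℕ} (hf : ∀ m ≤ n, 0 ≤ coeff m f)
    (hg : ∀ m ≤ n, 0 ≤ coeff m g) : ∀ m ≤ n, 0 ≤ coeff m (f * g) := fun m hm => by
  rw [coeff_mul]
  refine Finset.sum_nonneg fun p hp => mul_nonneg (hf _ ?_) (hg _ ?_) <;>
    have := Finset.HasAntidiagonal.mem_antidiagonal.1 hp <;> omega

/-- The factor `X` makes coefficient `n + 1` a nonnegative polynomial expression in earlier
coefficients. -/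
theorem nonnegCoeffs_of_system {L E K : PowerSeries ℝ}
    (hL : L = 1 + X * (L ^ 2 + X * ((1 + E) * L * K))) (hE : E = X * (1 + 2 * E))
    (hK : K = 1 + X * ((1 + L) * K)) :
    NonnegCoeffs L ∧ NonnegCoeffs E ∧ NonnegCoeffs K := by
  have hadd : ∀ {f g : PowerSeries ℝ} {n : ℕ}, (∀ m ≤ n, 0 ≤ coeff m f) →
      (∀ m ≤ n, 0 ≤ coeff m g) → ∀ m ≤ n, 0 ≤ coeff m (f + g) := fun hf hg m hm => by
    rw [map_add]
    exact add_nonneg (hf m hm) (hg m hm)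
  have key : ∀ n, (∀ m ≤ n, 0 ≤ coeff m L) ∧ (∀ m ≤ n, 0 ≤ coeff m E) ∧
      ∀ m ≤ n, 0 ≤ coeff m K := by
    intro n
    induction n with
    | zero =>
      refine ⟨fun m hm => ?_, fun m hm => ?_, fun m hm => ?_⟩ <;> obtain rfl := Nat.le_zero.1 hm
      · rw [hL]; simp
      · rw [hE]; simp
      · rw [hK]; simp
    | succ n ih =>
      obtain ⟨iL, iE, iK⟩ := ih
      have i1 : ∀ m ≤ n, 0 ≤ coeff m (1 : PowerSeries ℝ) := fun m _ => NonnegCoeffs.one m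
      have iX : ∀ m ≤ n, 0 ≤ coeff m (X : PowerSeries ℝ) := fun m _ => NonnegCoeffs.X m
      refine ⟨fun m hm => ?_, fun m hm => ?_, fun m hm => ?_⟩ <;>
        rcases Nat.le_succ_iff.1 hm with hm | rfl
      · exact iL m hm
      · rw [hL, map_add, coeff_succ_X_mul, pow_two]
        exact add_nonneg (NonnegCoeffs.one _) (hadd (coeff_mul_nonneg_of_le iL iL)
          (coeff_mul_nonneg_of_le iX (coeff_mul_nonneg_of_le
            (coeff_mul_nonneg_of_le (hadd i1 iE) iL) iK)) n le_rfl)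
      · exact iE m hm
      · rw [hE, coeff_succ_X_mul, two_mul]
        exact hadd i1 (hadd iE iE) n le_rfl
      · exact iK m hm
      · rw [hK, map_add, coeff_succ_X_mul]
        exact add_nonneg (NonnegCoeffs.one _)
          (coeff_mul_nonneg_of_le (hadd i1 iL) iK n le_rfl)
  exact ⟨fun n => (key n).1 n le_rfl, fun n => (key n).2.1 n le_rfl, fun n => (key n).2.2 n le_rfl⟩

/-- The partial sum of the first `N` terms of a power series at `x`. -/
noncomputable def partialEval (N : ℕ) (f : PowerSeries ℝ) (x : ℝ) : ℝ :=
  ∑ n ∈ Finset.range N, coeff n f * x ^ n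

section partialEval

variable {f g : PowerSeries ℝ} {x : ℝ} (N : ℕ)

theorem partialEval_add : partialEval N (f + g) x = partialEval N f x + partialEval N g x := by
  simp only [partialEval, map_add, add_mul, Finset.sum_add_distrib]

theorem partialEval_X_mul : partialEval (N + 1) (X * f) x = x * partialEval N f x := by
  rw [partialEval, Finset.sum_range_succ', coeff_zero_X_mul, partialEval, Finset.mul_sum]
  simp only [coeff_succ_X_mul, zero_mul, add_zero]
  exact Finset.sum_congr rfl fun n _ => by ring

theorem partialEval_X_mul_le (hf : NonnegCoeffs f) (hx : 0 ≤ x) :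
    partialEval N (X * f) x ≤ x * partialEval N f x := by
  rw [← partialEval_X_mul, partialEval, partialEval, Finset.sum_range_succ]
  exact le_add_of_nonneg_right (mul_nonneg (NonnegCoeffs.X.mul hf _) (pow_nonneg hx _))

theorem partialEval_one_le : partialEval N 1 x ≤ 1 := by
  rcases N with _ | N
  · simp [partialEval]
  · rw [partialEval, Finset.sum_range_succ']
    simp [coeff_one]

theorem partialEval_nonneg (hf : NonnegCoeffs f) (hx : 0 ≤ x) : 0 ≤ partialEval N f x :=
  Finset.sum_nonneg fun n _ => mul_nonneg (hf n) (pow_nonneg hx n)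

theorem partialEval_mul_le (hf : NonnegCoeffs f) (hg : NonnegCoeffs g) (hx : 0 ≤ x) :
    partialEval N (f * g) x ≤ partialEval N f x * partialEval N g x := by
  have h1 : partialEval N (f * g) x = ∑ m ∈ Finset.range N, ∑ k ∈ Finset.range (m + 1),
      (coeff k f * x ^ k) * (coeff (m - k) g * x ^ (m - k)) := by
    refine Finset.sum_congr rfl fun m _ => ?_
    rw [coeff_mul, Finset.Nat.sum_antidiagonal_eq_sum_range_succ (fun i j => coeff i f * coeff j g),
      Finset.sum_mul]
    refine Finset.sum_congr rfl fun k hk => ?_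
    rw [← Nat.add_sub_of_le (Nat.lt_succ_iff.1 (Finset.mem_range.1 hk)), pow_add,
      Nat.add_sub_cancel_left]
    ring
  rw [h1, Finset.sum_range_diag_flip N
    (fun k j => (coeff k f * x ^ k) * (coeff j g * x ^ j)), partialEval, partialEval,
    Finset.sum_mul_sum]
  refine Finset.sum_le_sum fun k _ => ?_
  refine Finset.sum_le_sum_of_subset_of_nonneg (Finset.range_mono (Nat.sub_le N k)) fun j _ _ => ?_
  exact mul_nonneg (mul_nonneg (hf k) (pow_nonneg hx k)) (mul_nonneg (hg j) (pow_nonneg hx j))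

end partialEval

/-- The system is monotone, and truncation at `N + 1` is controlled by truncation at `N`. Any
nonnegative real solution at `x` therefore dominates all partial sums, by induction from the empty
ones. -/
theorem partialEval_le_of_system {L E K F : PowerSeries ℝ}
    (hL : L = 1 + X * (L ^ 2 + X * ((1 + E) * L * K))) (hE : E = X * (1 + 2 * E))
    (hK : K = 1 + X * ((1 + L) * K)) (hF : F = X * L * (1 + F)) (hF0 : NonnegCoeffs F)
    {x l e k b : ℝ} (hx : 0 ≤ x) (hl0 : 0 ≤ l) (he0 : 0 ≤ e) (hk0 : 0 ≤ k) (hb0 : 0 ≤ b)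
    (hl : l = 1 + x * (l ^ 2 + x * ((1 + e) * l * k))) (he : e = x * (1 + 2 * e))
    (hk : k = 1 + x * ((1 + l) * k)) (hb : b = x * (l * (1 + b))) (N : ℕ) :
    partialEval N F x ≤ b := by
  obtain ⟨pL, pE, pK⟩ := nonnegCoeffs_of_system hL hE hK
  have key : partialEval N L x ≤ l ∧ partialEval N E x ≤ e ∧ partialEval N K x ≤ k ∧
      partialEval N F x ≤ b := by
    induction N with
    | zero =>
      simp only [partialEval, Finset.range_zero, Finset.sum_empty]
      exact ⟨hl0, he0, hk0, hb0⟩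
    | succ N ih =>
      obtain ⟨iL, iE, iK, iF⟩ := ih
      have o : ∀ M, partialEval M (1 : PowerSeries ℝ) x ≤ 1 := fun M => partialEval_one_le M
      have q : ∀ {f g : PowerSeries ℝ} {u v : ℝ}, NonnegCoeffs f → NonnegCoeffs g → 0 ≤ u →
          partialEval N f x ≤ u → partialEval N g x ≤ v → partialEval N (f * g) x ≤ u * v := by
        intro f g u v hf hg hu h1 h2
        exact (partialEval_mul_le N hf hg hx).trans
          (mul_le_mul h1 h2 (partialEval_nonneg N hg hx) hu)
      have q1 : ∀ {f g : PowerSeries ℝ} {u v : ℝ} (M : ℕ), partialEval M f x ≤ u →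
          partialEval M g x ≤ v → partialEval M (f + g) x ≤ u + v := by
        intro f g u v M h1 h2
        rw [partialEval_add]
        exact add_le_add h1 h2
      refine ⟨?_, ?_, ?_, ?_⟩
      · rw [hL, hl]
        refine q1 (N + 1) (o (N + 1)) ?_
        rw [partialEval_X_mul, pow_two, pow_two]
        refine mul_le_mul_of_nonneg_left (q1 N (q pL pL hl0 iL iL) ?_) hx
        have hp := (NonnegCoeffs.one.add pE).mul pL
        refine (partialEval_X_mul_le N (hp.mul pK) hx).trans (mul_le_mul_of_nonneg_left ?_ hx)
        exact q hp pK (by positivity) (q (NonnegCoeffs.one.add pE) pL (by positivity)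
          (q1 N (o N) iE) iL) iK
      · rw [hE, he, partialEval_X_mul, two_mul, two_mul]
        exact mul_le_mul_of_nonneg_left (q1 N (o N) (q1 N iE iE)) hx
      · rw [hK, hk]
        refine q1 (N + 1) (o (N + 1)) ?_
        rw [partialEval_X_mul]
        exact mul_le_mul_of_nonneg_left
          (q (NonnegCoeffs.one.add pL) pK (by positivity) (q1 N (o N) iL) iK) hx
      · rw [hF, hb, mul_assoc, partialEval_X_mul]
        exact mul_le_mul_of_nonneg_left
          (q pL (NonnegCoeffs.one.add hF0) hl0 iL (q1 N (o N) iF)) hx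
  exact key.2.2.2

section eval

variable {f g : PowerSeries ℝ} {x y z : ℝ}

/-- The power series `f` converges at `x` with sum `y`. -/
def SumsTo (f : PowerSeries ℝ) (x y : ℝ) : Prop :=
  HasSum (fun n => coeff n f * x ^ n) y

theorem SumsTo.add (hf : SumsTo f x y) (hg : SumsTo g x z) : SumsTo (f + g) x (y + z) := by
  have := HasSum.add hf hg
  refine this.congr_fun fun n => ?_
  rw [map_add, add_mul]

theorem SumsTo.mul (hf : SumsTo f x y) (hg : SumsTo g x z) : SumsTo (f * g) x (y * z) := by
  have h1 : Summable fun n => ‖coeff n f * x ^ n‖ := Summable.norm (HasSum.summable hf)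
  have h2 : Summable fun n => ‖coeff n g * x ^ n‖ := Summable.norm (HasSum.summable hg)
  have h3 := tsum_mul_tsum_eq_tsum_sum_antidiagonal_of_summable_norm h1 h2
  have h4 := (summable_norm_sum_mul_antidiagonal_of_summable_norm h1 h2).of_norm.hasSum
  rw [← h3, HasSum.tsum_eq hf, HasSum.tsum_eq hg] at h4
  have h5 : ∀ n, ∑ kl ∈ Finset.HasAntidiagonal.antidiagonal n,
      coeff kl.1 f * x ^ kl.1 * (coeff kl.2 g * x ^ kl.2) = coeff n (f * g) * x ^ n := by
    intro n
    rw [coeff_mul, Finset.sum_mul]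
    refine Finset.sum_congr rfl fun p hp => ?_
    rw [← Finset.HasAntidiagonal.mem_antidiagonal.1 hp, pow_add]
    ring
  simp only [h5] at h4
  exact h4

theorem SumsTo.one : SumsTo 1 x 1 := by
  have := hasSum_single (f := fun n => coeff n (1 : PowerSeries ℝ) * x ^ n) 0 fun n hn => by
    simp [coeff_one, hn]
  rwa [coeff_zero_one, pow_zero, mul_one] at this

theorem SumsTo.X : SumsTo PowerSeries.X x x := by
  have := hasSum_single (f := fun n => coeff n (PowerSeries.X : PowerSeries ℝ) * x ^ n) 1 fun n hn => by
    simp [coeff_X, hn]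
  rwa [coeff_one_X, pow_one, one_mul] at this

theorem SumsTo.unique (h : SumsTo f x y) (h' : SumsTo f x z) : y = z :=
  HasSum.unique h h'

theorem SumsTo.exists_of_le (h : SumsTo f x y) (hx : 0 ≤ x) (hg : NonnegCoeffs g)
    (hfg : NonnegCoeffs (f - g)) : ∃ z, 0 ≤ z ∧ SumsTo g x z := by
  have hs : Summable fun n => coeff n g * x ^ n := by
    refine Summable.of_nonneg_of_le (fun n => mul_nonneg (hg n) (pow_nonneg hx n)) (fun n => ?_)
      (HasSum.summable h)
    have := hfg n
    rw [map_sub, sub_nonneg] at this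
    exact mul_le_mul_of_nonneg_right this (pow_nonneg hx n)
  exact ⟨_, tsum_nonneg fun n => mul_nonneg (hg n) (pow_nonneg hx n), hs.hasSum⟩

theorem SumsTo.exists_of_X_mul (h : SumsTo (PowerSeries.X * f) x y) (hx : 0 < x) :
    SumsTo f x (y / x) := by
  have := (hasSum_nat_add_iff' 1).2 h
  simp only [Finset.sum_range_one, coeff_zero_X_mul, zero_mul, sub_zero, coeff_succ_X_mul] at this
  refine (this.div_const x).congr_fun fun n => ?_
  rw [pow_succ]
  field_simp

end eval

/-- Convergence of the generating function at `x` yields a positive solution of the system. -/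
theorem exists_solution_of_sumsTo {L E K F : PowerSeries ℝ}
    (hL : L = 1 + X * (L ^ 2 + X * ((1 + E) * L * K))) (hE : E = X * (1 + 2 * E))
    (hK : K = 1 + X * ((1 + L) * K)) (hF : F = X * L * (1 + F)) (hF0 : NonnegCoeffs F)
    {x y : ℝ} (hx : 0 < x) (h : SumsTo F x y) :
    ∃ l e k : ℝ, 0 ≤ l ∧ 0 ≤ e ∧ 0 ≤ k ∧ l = 1 + x * (l * l + x * ((1 + e) * l * k)) ∧
      e = x * (1 + (e + e)) ∧ k = 1 + x * ((1 + l) * k) := by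
  obtain ⟨pL, pE, pK⟩ := nonnegCoeffs_of_system hL hE hK
  have p1 := NonnegCoeffs.one
  have pX := NonnegCoeffs.X
  -- `F` dominates `X * L` coefficientwise, their difference being `X * L * F`.
  obtain ⟨w, hw0, hw⟩ := h.exists_of_le hx.le (pX.mul pL) (by
    have := (pX.mul pL).mul hF0
    rwa [show F - X * L = X * L * F by linear_combination hF])
  have hLe := hw.exists_of_X_mul hx
  have hl0 : 0 ≤ w / x := by positivity
  -- both `K` and `E` are dominated by the inner term of the equation for `L`
  have pT : NonnegCoeffs ((1 + E) * L * K) := ((p1.add pE).mul pL).mul pK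
  obtain ⟨t, ht0, ht⟩ := hLe.exists_of_le hx.le (pX.mul (pX.mul pT)) (by
    have := p1.add (pX.mul (pL.mul pL))
    rwa [show L - X * (X * ((1 + E) * L * K)) = 1 + X * (L * L) by linear_combination hL])
  replace ht := (ht.exists_of_X_mul hx).exists_of_X_mul hx
  have pL1 : NonnegCoeffs (L - 1) := by
    have := pX.mul ((pL.mul pL).add (pX.mul pT))
    rwa [show L - 1 = X * (L * L + X * ((1 + E) * L * K)) by linear_combination hL]
  have pK1 : NonnegCoeffs (K - 1) := by
    have := pX.mul ((p1.add pL).mul pK)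
    rwa [show K - 1 = X * ((1 + L) * K) by linear_combination hK]
  obtain ⟨k, hk0, hk⟩ := ht.exists_of_le hx.le pK (by
    have := (pL1.mul pK).add (pE.mul (pL.mul pK))
    rwa [show (1 + E) * L * K - K = (L - 1) * K + E * (L * K) by ring])
  obtain ⟨e, he0, he⟩ := ht.exists_of_le hx.le pE (by
    have := ((pL.mul pK).add (pE.mul (pL1.mul pK))).add (pE.mul pK1)
    rwa [show (1 + E) * L * K - E = L * K + E * ((L - 1) * K) + E * (K - 1) by ring])
  have o : SumsTo 1 x 1 := SumsTo.one
  have v : SumsTo X x x := SumsTo.X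
  refine ⟨w / x, e, k, hl0, he0, hk0, ?_, ?_, ?_⟩
  · refine hLe.unique ?_
    rw [hL, pow_two]
    exact o.add (v.mul ((hLe.mul hLe).add (v.mul (((o.add he).mul hLe).mul hk))))
  · refine he.unique ?_
    rw [hE, two_mul]
    exact v.mul (o.add (he.add he))
  · refine hk.unique ?_
    rw [hK]
    exact o.add (v.mul ((o.add hLe).mul hk))

/-- Coefficients of a series of sequences are supermultiplicative. -/
theorem coeff_mul_le_coeff_add {W b : PowerSeries ℝ} (hW : NonnegCoeffs W) (hb : NonnegCoeffs b)
    (h : b = 1 + X * (W * b)) (m n : ℕ) : coeff m b * coeff n b ≤ coeff (m + n) b := by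
  induction m using Nat.strong_induction_on with
  | _ m ih =>
    rcases m with _ | m
    · have h0 : coeff 0 b = 1 := by
        rw [h, map_add, coeff_zero_X_mul]
        simp
      rw [h0, one_mul, zero_add]
    · have hc : ∀ k, coeff (k + 1) b =
          ∑ i ∈ Finset.range (k + 1), coeff i W * coeff (k - i) b := by
        intro k
        conv_lhs => rw [h]
        rw [map_add, coeff_succ_X_mul, coeff_mul,
          Finset.Nat.sum_antidiagonal_eq_sum_range_succ (fun i j => coeff i W * coeff j b),
          coeff_one, if_neg (Nat.succ_ne_zero k), zero_add]
      rw [show m + 1 + n = (m + n) + 1 by omega, hc, hc, Finset.sum_mul]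
      -- The terms of the recursion with `i ≤ m` are compared by induction; the remaining ones at `m
      -- + n` are nonnegative and dropped.
      calc ∑ i ∈ Finset.range (m + 1), coeff i W * coeff (m - i) b * coeff n b
          ≤ ∑ i ∈ Finset.range (m + 1), coeff i W * coeff (m + n - i) b := by
            refine Finset.sum_le_sum fun i hi => ?_
            have hi' := Finset.mem_range.1 hi
            rw [mul_assoc, show m + n - i = (m - i) + n by omega]
            exact mul_le_mul_of_nonneg_left (ih (m - i) (by omega)) (hW i)
        _ ≤ _ := Finset.sum_le_sum_of_subset_of_nonneg (Finset.range_mono (by omega))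
            fun i _ _ => mul_nonneg (hW i) (hb _)

/-- The `n`-th roots of a supermultiplicative sequence with geometric upper bound converge. -/
theorem tendsto_rpow_of_supermultiplicative {b : ℕ → ℝ} (hb : ∀ n, 1 ≤ b n)
    (hmul : ∀ m n, b m * b n ≤ b (m + n)) {c B : ℝ} (hc : 0 < c) (hB : ∀ n, b n ≤ B * c ^ n) :
    ∃ l, 0 < l ∧ l ≤ c ∧ Tendsto (fun n : ℕ => b n ^ (1 / (n : ℝ))) atTop (nhds l) := by
  have hpos : ∀ n, 0 < b n := fun n => zero_lt_one.trans_le (hb n)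
  have hBpos : 0 < B := by
    have := (hpos 0).trans_le (hB 0)
    simpa using this
  -- Fekete's lemma is applied to the negative logarithm; the geometric bound gives boundedness
  -- below.
  have hsub : Subadditive fun n => -Real.log (b n) := by
    intro m n
    have := Real.log_le_log (mul_pos (hpos m) (hpos n)) (hmul m n)
    rw [Real.log_mul (hpos m).ne' (hpos n).ne'] at this
    linarith
  have hlog : ∀ n, Real.log (b n) ≤ Real.log B + n * Real.log c := by
    intro n
    have := Real.log_le_log (hpos n) (hB n)
    rwa [Real.log_mul hBpos.ne' (pow_pos hc n).ne', Real.log_pow] at this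
  have hbdd : BddBelow (Set.range fun n : ℕ => -Real.log (b n) / n) := by
    refine ⟨-(|Real.log B| + |Real.log c|), ?_⟩
    rintro _ ⟨n, rfl⟩
    rcases Nat.eq_zero_or_pos n with rfl | hn
    · simp only [Nat.cast_zero, div_zero]
      have := abs_nonneg (Real.log B)
      have := abs_nonneg (Real.log c)
      linarith
    · have hn1 : (1 : ℝ) ≤ n := by exact_mod_cast hn
      simp only
      rw [le_div_iff₀ (by linarith)]
      have h1 := hlog n
      have h2 := le_abs_self (Real.log B)
      have h3 := mul_le_mul_of_nonneg_left (le_abs_self (Real.log c)) (by linarith : (0 : ℝ) ≤ n)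
      have h4 := mul_le_mul_of_nonneg_right hn1 (abs_nonneg (Real.log B))
      linarith
  have hlim := hsub.tendsto_lim hbdd
  have hexp : ∀ᶠ n : ℕ in atTop, Real.exp (-(-Real.log (b n) / n)) = b n ^ (1 / (n : ℝ)) := by
    filter_upwards with n
    rw [Real.rpow_def_of_pos (hpos n)]
    congr 1
    ring
  have hT : Tendsto (fun n : ℕ => b n ^ (1 / (n : ℝ))) atTop (nhds (Real.exp (-hsub.lim))) :=
    ((Real.continuous_exp.tendsto _).comp hlim.neg).congr' hexp
  refine ⟨_, Real.exp_pos _, ?_, hT⟩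
  rw [← Real.le_log_iff_exp_le hc]
  have hup : Tendsto (fun n : ℕ => Real.log B / n + Real.log c) atTop (nhds (0 + Real.log c)) :=
    (tendsto_const_div_atTop_nhds_zero_nat (Real.log B)).add_const _
  rw [zero_add] at hup
  refine le_of_tendsto_of_tendsto hlim.neg hup ?_
  filter_upwards [eventually_gt_atTop 0] with n hn
  have hn' : (0 : ℝ) < n := by exact_mod_cast hn
  rw [neg_div, neg_neg, div_add' _ _ _ hn'.ne', div_le_div_iff_of_pos_right hn']
  linarith [hlog n]

/-- The root test for convergence. -/
theorem summable_of_tendsto_rpow {b : ℕ → ℝ} (hb : ∀ n, 0 ≤ b n) {l x : ℝ} (hx : 0 < x)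
    (hlx : l * x < 1) (h : Tendsto (fun n : ℕ => b n ^ (1 / (n : ℝ))) atTop (nhds l)) :
    Summable fun n => b n * x ^ n := by
  obtain ⟨c, hlc, hcx⟩ := exists_between ((lt_div_iff₀ hx).2 hlx)
  have hl : 0 ≤ l := ge_of_tendsto' h fun n => Real.rpow_nonneg (hb n) _
  have hc : 0 < c := hl.trans_lt hlc
  have hcx' : c * x < 1 := (lt_div_iff₀ hx).1 hcx
  refine Summable.of_norm_bounded_eventually_nat
    (summable_geometric_of_lt_one (by positivity) hcx') ?_
  filter_upwards [h.eventually_lt_const hlc, eventually_gt_atTop 0] with n hn hn0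
  rw [Real.norm_of_nonneg (mul_nonneg (hb n) (pow_nonneg hx.le n)), mul_pow]
  refine mul_le_mul_of_nonneg_right ?_ (pow_nonneg hx.le n)
  have := pow_le_pow_left₀ (Real.rpow_nonneg (hb n) _) hn.le n
  rwa [one_div, Real.rpow_inv_natCast_pow (hb n) hn0.ne'] at this

end Growth

/-! ### The quintic and the double root of the kernel -/

section Constants

/-- The quintic has a greatest real root, close to `5.1955`. -/
theorem exists_greatest_root_quintic : ∃ γ : ℝ, 5.1955 ≤ γ ∧ γ ≤ 5.195545 ∧
    IsGreatest {x : ℝ | 2 - 41 * x + 101 * x ^ 2 - 97 * x ^ 3 + 36 * x ^ 4 - 4 * x ^ 5 = 0} γ := by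
  have hcont : ContinuousOn (fun x : ℝ =>
      2 - 41 * x + 101 * x ^ 2 - 97 * x ^ 3 + 36 * x ^ 4 - 4 * x ^ 5) (Set.Icc 5.1955 5.195545) := by
    fun_prop
  obtain ⟨γ, ⟨h1, h2⟩, h⟩ := intermediate_value_Icc' (by norm_num) hcont
    (show (0 : ℝ) ∈ _ from ⟨by norm_num, by norm_num⟩)
  refine ⟨γ, h1, h2, h, fun y hy => ?_⟩
  by_contra! hc
  simp only [Set.mem_ofPred_eq] at hy h
  -- Expanded about 5, the quintic has only negative nonconstant coefficients, so it is strictly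
  -- decreasing from 5 on.
  obtain ⟨s, rfl⟩ : ∃ s, y = 5 + s := ⟨y - 5, by ring⟩
  obtain ⟨t, rfl⟩ : ∃ t, γ = 5 + t := ⟨γ - 5, by ring⟩
  have ht : 0 ≤ t := by linarith
  have hts : t < s := by linarith
  have e2 := pow_lt_pow_left₀ hts ht (show 2 ≠ 0 by norm_num)
  have e3 := pow_lt_pow_left₀ hts ht (show 3 ≠ 0 by norm_num)
  have e4 := pow_lt_pow_left₀ hts ht (show 4 ≠ 0 by norm_num)
  have e5 := pow_lt_pow_left₀ hts ht (show 5 ≠ 0 by norm_num)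
  ring_nf at hy h
  linarith

/-- At the reciprocal of the quintic's root, the kernel cubic has a double root `w₀`. -/
theorem exists_double_root {x : ℝ} (h1 : 0.1924 ≤ x) (h2 : x ≤ 0.1925)
    (h : 2 * x ^ 5 - 41 * x ^ 4 + 101 * x ^ 3 - 97 * x ^ 2 + 36 * x - 4 = 0) :
    ∃ w₀, 0 < w₀ ∧ w₀ < 1 / 2 ∧ ∀ w,
      (1 - 2 * x) * (1 - x - w) * (w - x - w ^ 2) - x ^ 2 * (1 - x) * w =
        (1 - 2 * x) * (w - w₀) ^ 2 * (w - (2 - x - 2 * w₀)) := by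
  have hx2 : 0.1924 ^ 2 ≤ x ^ 2 := pow_le_pow_left₀ (by norm_num) h1 2
  have hx2' : x ^ 2 ≤ 0.1925 ^ 2 := pow_le_pow_left₀ (by linarith) h2 2
  have hx3 : 0.1924 ^ 3 ≤ x ^ 3 := pow_le_pow_left₀ (by norm_num) h1 3
  have hx3' : x ^ 3 ≤ 0.1925 ^ 3 := pow_le_pow_left₀ (by linarith) h2 3
  have hx4 : 0.1924 ^ 4 ≤ x ^ 4 := pow_le_pow_left₀ (by norm_num) h1 4
  have hx4' : x ^ 4 ≤ 0.1925 ^ 4 := pow_le_pow_left₀ (by linarith) h2 4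
  norm_num at hx2 hx2' hx3 hx3' hx4 hx4' h1 h2
  -- A double root of `w³ + bw² + cw + d` is `(9d - bc) / (2(b² - 3c))`; here `M` and `D` are `9d -
  -- bc` and `b² - 3c`, each multiplied by `1 - 2x`.
  obtain ⟨D, hD⟩ : ∃ D, D = 1 - 6 * x + 12 * x ^ 2 - 5 * x ^ 3 := ⟨_, rfl⟩
  obtain ⟨M, hM⟩ : ∃ M, M = 2 - 14 * x + 27 * x ^ 2 - 15 * x ^ 3 - x ^ 4 := ⟨_, rfl⟩
  have hD0 : 0 < D := by linarith
  have hM0 : 0 < M := by linarith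
  have hMD : M < D := by linarith
  have hw : ∃ w₀, w₀ * (2 * D) = M := ⟨M / (2 * D), by field_simp⟩
  obtain ⟨w₀, hw⟩ := hw
  -- The third root is chosen to give the right sum of roots; `hi` and `hii` match the linear and
  -- constant coefficients. Both hold modulo the quintic, and the cofactors of `h` are the
  -- quotients.
  have hi : (1 - 2 * x) * (-3 * w₀ ^ 2 + 2 * (2 - x) * w₀) = 1 - 2 * x - x ^ 2 + x ^ 3 := by
    have hne : (4 * D ^ 2) ≠ 0 := by positivity
    refine mul_left_cancel₀ hne ?_
    have e : (1 - 2 * x) * (-3 * M ^ 2 + 4 * (2 - x) * M * D) =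
        4 * D ^ 2 * (1 - 2 * x - x ^ 2 + x ^ 3) := by
      rw [hD, hM]
      linear_combination (-9 * x ^ 2 + 27 * x ^ 3 - 27 * x ^ 4) * h
    rw [← e, ← hw]
    ring
  have hii : w₀ ^ 2 * (2 - x - 2 * w₀) = x * (1 - x) := by
    have hne : (4 * D ^ 3) ≠ 0 := by positivity
    refine mul_left_cancel₀ hne ?_
    have e : M ^ 2 * ((2 - x) * D - M) = 4 * D ^ 3 * (x * (1 - x)) := by
      rw [hD, hM]
      linear_combination (-8 * x ^ 2 + 63 * x ^ 3 - 174 * x ^ 4 + 217 * x ^ 5 - 102 * x ^ 6 +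
        3 * x ^ 7) * h
    rw [← e, ← hw]
    ring
  refine ⟨w₀, ?_, ?_, fun w => ?_⟩
  · exact (mul_pos_iff_of_pos_right (by linarith : 0 < 2 * D)).1 (hw.symm ▸ hM0)
  · exact lt_of_mul_lt_mul_right (by linarith : w₀ * (2 * D) < 1 / 2 * (2 * D)) (by linarith)
  · linear_combination (-w) * hi + (1 - 2 * x) * hii

end Constants

/-! ### Determination of the growth rate -/

section GrowthRate

open PowerSeries Filter

/-- The kernel inequality excludes solutions of the system to the right of the critical point. -/
theorem no_solution_of_gt {x₀ w₀ x l e k : ℝ} (hx₀ : 0 < x₀) (hx₀' : x₀ < 1 / 2)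
    (hw₀' : w₀ < 1 / 2)
    (hfac : ∀ w, (1 - 2 * x₀) * (1 - x₀ - w) * (w - x₀ - w ^ 2) - x₀ ^ 2 * (1 - x₀) * w =
      (1 - 2 * x₀) * (w - w₀) ^ 2 * (w - (2 - x₀ - 2 * w₀)))
    (hx : x₀ < x) (hl0 : 0 ≤ l) (he0 : 0 ≤ e) (hk0 : 0 ≤ k)
    (hl : l = 1 + x * (l * l + x * ((1 + e) * l * k))) (he : e = x * (1 + (e + e)))
    (hk : k = 1 + x * ((1 + l) * k)) : False := by
  have hxp : 0 < x := hx₀.trans hx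
  obtain ⟨w, hw⟩ : ∃ w, w = x * l := ⟨_, rfl⟩
  have hw0 : 0 ≤ w := by rw [hw]; positivity
  have hk1 : k * (1 - x - w) = 1 := by rw [hw]; linear_combination hk
  have he1 : (1 + e) * (1 - 2 * x) = 1 - x := by linear_combination he
  have hwx : 0 < 1 - x - w := by
    by_contra! hc
    nlinarith
  have h2x : 0 < 1 - 2 * x := by
    by_contra! hc
    nlinarith
  have heq : w - x - w ^ 2 = x ^ 2 * (1 + e) * w * k := by
    rw [hw]
    linear_combination x * hl
  have hu : 0 < 1 - 2 * x₀ := by linarith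
  have hv : 0 < 1 - x₀ - w := by linarith
  -- Since `w < 1 - x₀` and `w₀ < 1/2`, `w` lies below the third root.
  have hneg : (1 - 2 * x₀) * (w - w₀) ^ 2 * (w - (2 - x₀ - 2 * w₀)) ≤ 0 :=
    mul_nonpos_of_nonneg_of_nonpos (by positivity) (by linarith)
  rw [← hfac] at hneg
  have hk2 : 1 ≤ k * (1 - x₀ - w) := by nlinarith
  have he2 : 1 - x₀ ≤ (1 + e) * (1 - 2 * x₀) := by nlinarith
  have hprod : 1 - x₀ ≤ ((1 + e) * (1 - 2 * x₀)) * (k * (1 - x₀ - w)) := by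
    calc 1 - x₀ = (1 - x₀) * 1 := by ring
      _ ≤ _ := mul_le_mul he2 hk2 zero_le_one (by positivity)
  have hsq : x₀ ^ 2 ≤ x ^ 2 := pow_le_pow_left₀ hx₀.le hx.le 2
  -- After cancelling the positive factors this reads `w - x₀ - w² ≤ w - x - w²` by `heq`,
  -- contradicting `x₀ < x`.
  have hfin : (1 - 2 * x₀) * (1 - x₀ - w) * (w - x₀ - w ^ 2) ≤
      (1 - 2 * x₀) * (1 - x₀ - w) * (x ^ 2 * (1 + e) * w * k) := by
    calc (1 - 2 * x₀) * (1 - x₀ - w) * (w - x₀ - w ^ 2) ≤ x₀ ^ 2 * (1 - x₀) * w := by linarith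
      _ ≤ x ^ 2 * (((1 + e) * (1 - 2 * x₀)) * (k * (1 - x₀ - w))) * w := by
        refine mul_le_mul_of_nonneg_right (mul_le_mul hsq hprod (by linarith) (by positivity)) hw0
      _ = _ := by ring
  have := le_of_mul_le_mul_left hfin (mul_pos hu hv)
  linarith

/-- The double root bounds the growth from above, supermultiplicativity gives the limit, and the
kernel inequality excludes a smaller one. -/
theorem hasGrowthRate_classE {γ : ℝ} (h1 : 5.1955 ≤ γ) (h2 : γ ≤ 5.195545)
    (h : 2 - 41 * γ + 101 * γ ^ 2 - 97 * γ ^ 3 + 36 * γ ^ 4 - 4 * γ ^ 5 = 0) :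
    HasGrowthRate classE γ := by
  have hγ : 0 < γ := by linarith
  obtain ⟨x, hx⟩ : ∃ x, x = γ⁻¹ := ⟨_, rfl⟩
  have hxγ : x * γ = 1 := by rw [hx]; exact inv_mul_cancel₀ hγ.ne'
  have hx0 : 0 < x := by rw [hx]; positivity
  have hx1 : 0.1924 ≤ x := by nlinarith
  have hx2 : x ≤ 0.1925 := by nlinarith
  have hquint : 2 * x ^ 5 - 41 * x ^ 4 + 101 * x ^ 3 - 97 * x ^ 2 + 36 * x - 4 = 0 := by
    rw [hx]
    field_simp
    linear_combination h
  obtain ⟨w₀, hw0, hw1, hfac⟩ := exists_double_root hx1 hx2 hquint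
  norm_num at hx1 hx2
  obtain ⟨L, E, K, hL, hE, hK⟩ := exists_series_system (𝕜 := ℝ)
  have hF := classSeries_eq hL hE hK
  have hcoeff : ∀ n, coeff n (classSeries ℝ) = (Nat.card (classE n) : ℝ) := fun n => by
    rw [classSeries, coeff_mk]
  have hF0 : NonnegCoeffs (classSeries ℝ) := fun n => by
    rw [hcoeff]
    exact Nat.cast_nonneg _
  obtain ⟨pL, pE, pK⟩ := nonnegCoeffs_of_system hL hE hK
  -- upper bound at the critical point
  have hbound : ∀ n, (Nat.card (classE n) : ℝ) ≤ w₀ / (1 - w₀) * γ ^ n := by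
    have hu : 0 < 1 - 2 * x := by linarith
    have hv : 0 < 1 - x - w₀ := by linarith
    have hw : 0 < 1 - w₀ := by linarith
    have hu' : 1 - x * 2 ≠ 0 := by linarith
    have hf := hfac w₀
    rw [sub_self, zero_pow two_ne_zero, mul_zero, zero_mul] at hf
    intro n
    -- The values are the closed forms of `L`, `E`, `K` and `F` in terms of `x` and `w₀ = x * l`;
    -- the equation for `l` is the kernel cubic at `w₀`.
    have := partialEval_le_of_system hL hE hK hF hF0 (x := x) (l := w₀ / x) (e := x / (1 - 2 * x))
      (k := 1 / (1 - x - w₀)) (b := w₀ / (1 - w₀)) hx0.le (by positivity) (by positivity)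
      (by positivity) (by positivity) (by
        field_simp
        linear_combination hf) (by field_simp; ring) (by field_simp; ring)
      (by field_simp; ring) (n + 1)
    rw [partialEval, Finset.sum_range_succ, hcoeff] at this
    have hs : 0 ≤ ∑ i ∈ Finset.range n, coeff i (classSeries ℝ) * x ^ i :=
      Finset.sum_nonneg fun i _ => mul_nonneg (hF0 i) (pow_nonneg hx0.le i)
    have h3 : (Nat.card (classE n) : ℝ) * x ^ n ≤ w₀ / (1 - w₀) := by linarith
    have h4 := mul_le_mul_of_nonneg_right h3 (pow_nonneg hγ.le n)
    rwa [mul_assoc, ← mul_pow, hxγ, one_pow, mul_one] at h4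
  -- supermultiplicativity
  have hb : (1 + classSeries ℝ) = 1 + X * (L * (1 + classSeries ℝ)) := by
    linear_combination hF
  have hmul := coeff_mul_le_coeff_add pL (NonnegCoeffs.one.add hF0) hb
  -- The class is empty at length 0, so the added 1 supplies the constant term that a
  -- supermultiplicative sequence needs.
  have hzero : coeff 0 (1 + classSeries ℝ) = 1 := by
    rw [map_add, hcoeff, card_classE_zero]
    simp
  have hone : coeff 1 (1 + classSeries ℝ) = 1 := by
    have := card_classE_succ 0
    rw [zero_add] at this
    rw [map_add, hcoeff, this, coeff_one]
    simp [labelWeight]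
  have hge : ∀ n, 1 ≤ coeff n (1 + classSeries ℝ) := by
    intro n
    induction n with
    | zero => exact hzero.ge
    | succ n ih =>
      have := hmul n 1
      rw [hone, mul_one] at this
      exact ih.trans this
  have hpos : ∀ n, 0 < n → coeff n (1 + classSeries ℝ) = (Nat.card (classE n) : ℝ) := by
    intro n hn
    rw [map_add, coeff_one, if_neg hn.ne', zero_add, hcoeff]
  have hB : ∀ n, coeff n (1 + classSeries ℝ) ≤ (1 + w₀ / (1 - w₀)) * γ ^ n := by
    intro n
    rw [map_add, hcoeff, add_mul, one_mul]
    refine add_le_add ?_ (hbound n)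
    refine le_trans ?_ (one_le_pow₀ (by linarith : 1 ≤ γ))
    rw [coeff_one]
    split_ifs <;> norm_num
  obtain ⟨l, hl0, hlγ, hl⟩ := tendsto_rpow_of_supermultiplicative hge hmul hγ hB
  have hl' : HasGrowthRate classE l := by
    refine hl.congr' ?_
    filter_upwards [eventually_gt_atTop 0] with n hn
    rw [hpos n hn]
  -- lower bound
  rcases hlγ.eq_or_lt with rfl | hlt
  · exact hl'
  exfalso
  have hxl : x < 1 / l := by
    rw [lt_div_iff₀ hl0, ← hxγ]
    exact mul_lt_mul_of_pos_left hlt hx0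
  -- A point beyond the critical one but still inside the disc of convergence that the smaller limit
  -- would give.
  obtain ⟨x₁, hx₁, hx₁l⟩ := exists_between hxl
  have hsum := summable_of_tendsto_rpow (fun n => Nat.cast_nonneg _) (hx0.trans hx₁)
    (by rw [mul_comm]; exact (lt_div_iff₀ hl0).1 hx₁l) hl'
  have hsums : SumsTo (classSeries ℝ) x₁ (∑' n, (Nat.card (classE n) : ℝ) * x₁ ^ n) := by
    refine hsum.hasSum.congr_fun fun n => ?_
    rw [hcoeff]
  obtain ⟨l', e, k, hl'0, he0, hk0, hl', he, hk⟩ :=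
    exists_solution_of_sumsTo hL hE hK hF hF0 (hx0.trans hx₁) hsums
  exact no_solution_of_gt hx0 (by linarith) hw1 hfac hx₁ hl'0 he0 hk0 hl' he hk

end GrowthRate

theorem mainTheorem9 :
    IsAlgebraic (Polynomial ℚ) (permGenFun classE) ∧
    ((PowerSeries.X - 3 * PowerSeries.X ^ 2 + 2 * PowerSeries.X ^ 3 : PowerSeries ℚ)
        - (1 - 5 * PowerSeries.X + 8 * PowerSeries.X ^ 2 - 5 * PowerSeries.X ^ 3)
            * permGenFun classE
        + (2 * PowerSeries.X - 5 * PowerSeries.X ^ 2 + 4 * PowerSeries.X ^ 3)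
            * permGenFun classE ^ 2
        + PowerSeries.X ^ 3 * permGenFun classE ^ 3 = 0) ∧
    ∃ γ : ℝ, HasGrowthRate classE γ ∧
      IsGreatest
        {x : ℝ | 2 - 41 * x + 101 * x ^ 2 - 97 * x ^ 3 + 36 * x ^ 4 - 4 * x ^ 5 = 0} γ ∧
      |γ - 5.1955| < 0.00005 := by
  obtain ⟨γ, h1, h2, hγ⟩ := exists_greatest_root_quintic
  refine ⟨isAlgebraic_classSeries, classSeries_cubic, γ, hasGrowthRate_classE h1 h2 hγ.1, hγ, ?_⟩
  rw [abs_lt]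
  constructor <;> linarith
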